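/- Let $n\ge 1$ and let $b\in C^\infty([0,\infty);\mathbb R)$ satisfy - (H1) $b(t)\ge 0$; - (H2) $b$ is monotone; - (H3) for every integer $k\ge 1$ there is a constant $C_k$ with $\left|\frac{\mathrm d^k}{\mathrm dt^k}b(t)\right|\le C_k\, b(t)\,(1+t)^{-k}$ for all $t\ge 0$; - (NE) $\displaystyle\limsup_{t\to\infty} t\,b(t)<1$. Put $\lambda(t)=\exp\left(\frac12\int_0^t b(\tau)\,\mathrm d\tau\right)$. For $(f_1,f_2)\in L^2(\mathbb R^n;\mathbb C^2)$ let $u\in C([0,\infty);H^1(\mathbb R^n))\cap C^1([0,\infty);L^2(\mathbb R^n))$ be the solution (in the sense of tempered distributions in $x$) of the Cauchy problem $$u_{tt}-\Delta u+b(t)u_t=0,\qquad u(0,\cdot)=u_1,\quad \mathrm D_tu(0,\cdot)=u_2,$$ with $\langle \mathrm D\rangle u_1=f_1$ and $u_2=f_2$, where $\mathrm D_t=-i\partial_t$, $|\mathrm D|=(-\Delta)^{1/2}$ and $\langle \mathrm D\rangle=(1-\Delta)^{1/2}$. Then this solution exists for all such data, the energy operator $$\mathbb E(t):\ (\langle \mathrm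 D\rangle u_1,u_2)^T\mapsto(|\mathrm D|u(t,\cdot),\mathrm D_tu(t,\cdot))^T$$ is a well-defined bounded linear operator on $L^2(\mathbb R^n;\mathbb C^2)$ for every $t\ge 0$, and $$\|\mathbb E(t)\|_{2\to2}\sim\frac1{\lambda(t)},$$ that is, there are constants $c,C>0$ (independent of $t$) such that $\dfrac{c}{\lambda(t)}\le\|\mathbb E(t)\|_{2\to 2}\le\dfrac{C}{\lambda(t)}$ for all $t\ge 0$. -/

import Mathlib

open MeasureTheory Filter Topology Set FourierTransform
open scoped SchwartzMap Laplacian ContDiff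

noncomputable section

namespace DampedWave

/-- The complex Hilbert space `L²(ℝⁿ)`. -/
abbrev L2 (n : ℕ) : Type := Lp (α := EuclideanSpace ℝ (Fin n)) ℂ 2

/-- The energy space `L²(ℝⁿ; ℂ²)`, as the Hilbert space direct sum `L²(ℝⁿ) ⊕ L²(ℝⁿ)`. -/
abbrev L2Pair (n : ℕ) : Type := WithLp 2 (L2 n × L2 n)

/-- `g = m(D) f` in `L²(ℝⁿ)`, where `D = -i∇`. In particular `f` is in the domain of `m(D)`.
Mathlib's Fourier transform has the kernel `exp (-2πi x·ξ)`, so that `D` corresponds to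
multiplication by `2πξ`; here `m` is a function of the modulus of the frequency variable `2πξ`. -/
def IsMultiplierImage {n : ℕ} (m : ℝ → ℝ) (f g : L2 n) : Prop :=
  ∀ᵐ ξ : EuclideanSpace ℝ (Fin n),
    (𝓕 g : L2 n) ξ = (m (2 * Real.pi * ‖ξ‖) : ℂ) * (𝓕 f : L2 n) ξ

/-- `g = |D| f`; this entails `f ∈ H¹(ℝⁿ)`. -/
def IsAbsD {n : ℕ} (f g : L2 n) : Prop :=
  IsMultiplierImage (fun r => r) f g

/-- `g = ⟨D⟩ f` with `⟨D⟩ = (1 + |D|²)^(1/2)`; this entails `f ∈ H¹(ℝⁿ)`. -/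
def IsBracketD {n : ℕ} (f g : L2 n) : Prop :=
  IsMultiplierImage (fun r => √(1 + r ^ 2)) f g

/-- `u` is a solution of `u_tt - Δu + b(t) u_t = 0` on `[0, ∞) × ℝⁿ` in the energy class
`C([0,∞); H¹(ℝⁿ)) ∩ C¹([0,∞); L²(ℝⁿ))`, with time derivative `u_t = ut`. -/
structure IsEnergySolution {n : ℕ} (b : ℝ → ℝ) (u ut : ℝ → L2 n) : Prop where
  /-- `u ∈ C([0,∞); H¹)` -/
  continuous_sobolev : ∃ w : ℝ → L2 n, ContinuousOn w (Ici 0) ∧ ∀ t ≥ 0, IsBracketD (u t) (w t)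
  /-- `u` is differentiable with values in `L²`, with derivative `ut` -/
  hasDeriv : ∀ t ≥ 0, HasDerivWithinAt u (ut t) (Ici 0) t
  /-- `u_t ∈ C([0,∞); L²)` -/
  continuous_deriv : ContinuousOn ut (Ici 0)
  /-- `∂ₜ u_t = Δu - b(t) u_t` in the sense of tempered distributions on `ℝⁿ` -/
  equation : ∀ φ : 𝓢(EuclideanSpace ℝ (Fin n), ℂ), ∀ t ≥ 0,
    HasDerivWithinAt
      (fun s => (ut s : 𝓢'(EuclideanSpace ℝ (Fin n), ℂ)) φ)
      ((Δ (u t : 𝓢'(EuclideanSpace ℝ (Fin n), ℂ))) φ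
        - (b t : ℂ) * (ut t : 𝓢'(EuclideanSpace ℝ (Fin n), ℂ)) φ)
      (Ici 0) t

/-- `u` is a solution of the Cauchy problem `u_tt - Δu + b(t) u_t = 0`, `u(0) = u₁`,
`D_t u(0) = u₂`, where `D_t = -i∂_t`, and `f = (⟨D⟩u₁, u₂)` is its vector of data. -/
def IsSolutionWithData {n : ℕ} (b : ℝ → ℝ) (f : L2Pair n) (u ut : ℝ → L2 n) : Prop :=
  IsEnergySolution b u ut ∧ IsBracketD (u 0) f.fst ∧ (-Complex.I) • ut 0 = f.snd

/-- `E` is the energy operator `E(t) : (⟨D⟩u₁, u₂) ↦ (|D|u(t), D_t u(t))`, `t ≥ 0`, of the Cauchy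
problem `u_tt - Δu + b(t) u_t = 0`, `u(0) = u₁`, `D_t u(0) = u₂`: each vector of data in
`L²(ℝⁿ; ℂ²)` belongs to a solution, and for each solution with these data `E(t)` returns the
energy vector at the time `t`. These two properties determine `E(t)` for all `t ≥ 0`. -/
structure IsEnergyOperator {n : ℕ} (b : ℝ → ℝ) (E : ℝ → L2Pair n →L[ℂ] L2Pair n) : Prop where
  exists_solution : ∀ f : L2Pair n, ∃ u ut : ℝ → L2 n, IsSolutionWithData b f u ut
  energy_eq : ∀ (f : L2Pair n) (u ut : ℝ → L2 n), IsSolutionWithData b f u ut →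
    ∀ t ≥ 0, IsAbsD (u t) (E t f).fst ∧ (E t f).snd = (-Complex.I) • ut t

/-- `λ(t) = exp (½ ∫₀ᵗ b(τ) dτ)` -/
def lam (b : ℝ → ℝ) (t : ℝ) : ℝ := Real.exp (1 / 2 * ∫ τ in (0 : ℝ)..t, b τ)

end DampedWave

end

/-!
The Fourier transform in `x` turns the equation into the family of ordinary differential equations
`v'' + r² v + b v' = 0`, `r = |2πξ|`, and the energy operator into a matrix of Fourier multipliers.
Everything rests on estimates for these equations that are uniform in `r`.

* Energy estimates. The function `w = λ v` solves `w'' + (r² - b²/4 - b'/2) w = 0`. Below the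
  effective threshold `b = O((1 + t)⁻¹)` and `b' = O((1 + t)⁻²)`, so in the hyperbolic zone
  `r (1 + t) ≥ const` the potential is integrable with integral `O(r)`, and Gronwall's inequality
  shows that the energy of `w` stays comparable to itself (`IsMode.weightedEnergy_bounds`,
  `IsNoneffective.hyperbolic_bounds`). In the dissipative zone `r (1 + t) ≤ const` the term `r² v`
  is a perturbation of `(λ² v')' = 0`, and `∫₀ᵗ λ⁻¹ ≤ A (1 + t) / λ(t)` together with
  `λ(t) ≤ A (1 + t)` gives `λ |v'| + λ r |v| = O(1)` (`IsNoneffective.dissipative_bound`). These two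
  bounds are where the condition on `limsup t b(t)` enters (`exists_isNoneffective`). Gluing the
  zones gives the upper bound for all frequencies, and the frequencies `r ≥ 1`, which are
  hyperbolic from the start, give the lower bound.
* Existence. The solutions at frequency `r` are power series in `r²` whose coefficients are
  iterated integrals in time (`mode`), which makes them measurable in `r`. Dominated convergence
  (`tendsto_mulOp`) turns pointwise derivatives in `t` into derivatives in `L²`
  (`IsSymbolFlow.isEnergySolution`).
* Uniqueness. With the frequencies cut off to a ball, a solution in the sense of distributions
  solves a linear ordinary differential equation in `L²` with bounded coefficients
  (`IsEnergySolution.eq_zero`). Hence the multiplier matrix is the energy operator.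

The coefficient is extended to negative times by `b(max t 0)`, which is continuous on `ℝ`; neither
solutions nor `λ(t)`, `t ≥ 0`, notice the extension.
-/

namespace DampedWave

/-! ### The integrating factor and the solutions at a fixed frequency -/

lemma lam_pos (b : ℝ → ℝ) (t : ℝ) : 0 < lam b t := Real.exp_pos _

lemma lam_zero (b : ℝ → ℝ) : lam b 0 = 1 := by simp [lam]

lemma hasDerivAt_lam {b : ℝ → ℝ} (hb : Continuous b) (t : ℝ) :
    HasDerivAt (lam b) (b t / 2 * lam b t) t := by
  have h := ((intervalIntegral.integral_hasDerivAt_right (hb.intervalIntegrable 0 t)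
    hb.aestronglyMeasurable.stronglyMeasurableAtFilter hb.continuousAt).const_mul (1 / 2)).exp
  unfold lam
  convert! h using 1
  ring

lemma continuous_lam {b : ℝ → ℝ} (hb : Continuous b) : Continuous (lam b) :=
  continuous_iff_continuousAt.2 fun t => (hasDerivAt_lam hb t).continuousAt

lemma hasDerivAt_lam_sq {b : ℝ → ℝ} (hb : Continuous b) (t : ℝ) :
    HasDerivAt (fun s => lam b s ^ 2) (b t * lam b t ^ 2) t := by
  convert! (hasDerivAt_lam hb t).pow 2 using 1
  ring

lemma monotone_lam {b : ℝ → ℝ} (hb : Continuous b) (h0 : ∀ t, 0 ≤ b t) : Monotone (lam b) :=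
  monotone_of_deriv_nonneg (fun t => (hasDerivAt_lam hb t).differentiableAt) fun t => by
    rw [(hasDerivAt_lam hb t).deriv]
    have := lam_pos b t
    have := h0 t
    positivity

lemma one_le_lam {b : ℝ → ℝ} (hb : Continuous b) (h0 : ∀ t, 0 ≤ b t) {t : ℝ} (ht : 0 ≤ t) :
    1 ≤ lam b t := by
  simpa [lam_zero] using monotone_lam hb h0 ht

/-- `v` solves `v'' + r² v + b v' = 0` on `[0, ∞)`, and `v'` is its derivative. This is the wave
equation for the Fourier transform at a frequency of modulus `r`. -/
structure IsMode (b : ℝ → ℝ) (r : ℝ) (v v' : ℝ → ℝ) : Prop where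
  hasDeriv : ∀ t ≥ 0, HasDerivWithinAt v (v' t) (Ici 0) t
  hasDeriv' : ∀ t ≥ 0, HasDerivWithinAt v' (-(b t * v' t) - r ^ 2 * v t) (Ici 0) t

/-- `∫₀ᵗ λ² f`. -/
noncomputable def weightedPrimitive (b f : ℝ → ℝ) (t : ℝ) : ℝ :=
  ∫ s in (0 : ℝ)..t, lam b s ^ 2 * f s

/-- The solution operator of `(λ² g')' = λ² f`, `g(0) = g'(0) = 0`. -/
noncomputable def volterra (b f : ℝ → ℝ) (t : ℝ) : ℝ :=
  ∫ s in (0 : ℝ)..t, (lam b s ^ 2)⁻¹ * weightedPrimitive b f s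

/-- The iterates of the Volterra operator on the solution with data `(a, c)` of the equation
`(λ² g')' = 0` of frequency zero. -/
noncomputable def modeTerm (b : ℝ → ℝ) (a c : ℝ) : ℕ → ℝ → ℝ
  | 0 => fun t => a + c * ∫ s in (0 : ℝ)..t, (lam b s ^ 2)⁻¹
  | k + 1 => volterra b (modeTerm b a c k)

/-- The solution with data `(a, c)` of `v'' + r² v + b v' = 0`, as a power series in `r²`. -/
noncomputable def mode (b : ℝ → ℝ) (a c r t : ℝ) : ℝ :=
  ∑' k, (-r ^ 2) ^ k * modeTerm b a c k t

/-- The time derivative of `mode`. -/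
noncomputable def modeDeriv (b : ℝ → ℝ) (a c r t : ℝ) : ℝ :=
  (lam b t ^ 2)⁻¹ *
    (c + ∑' k, (-r ^ 2) ^ (k + 1) * weightedPrimitive b (modeTerm b a c k) t)

section Construction

variable {b : ℝ → ℝ}

lemma continuous_lam_sq_inv (hb : Continuous b) : Continuous fun t => (lam b t ^ 2)⁻¹ :=
  ((continuous_lam hb).pow 2).inv₀ fun t => (pow_pos (lam_pos b t) 2).ne'

lemma hasDerivAt_integral_of_continuous {f : ℝ → ℝ} (hf : Continuous f) (t : ℝ) :
    HasDerivAt (fun t => ∫ s in (0 : ℝ)..t, f s) (f t) t :=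
  intervalIntegral.integral_hasDerivAt_right (hf.intervalIntegrable 0 t)
    hf.aestronglyMeasurable.stronglyMeasurableAtFilter hf.continuousAt

lemma hasDerivAt_weightedPrimitive (hb : Continuous b) {f : ℝ → ℝ} (hf : Continuous f) (t : ℝ) :
    HasDerivAt (weightedPrimitive b f) (lam b t ^ 2 * f t) t :=
  hasDerivAt_integral_of_continuous (((continuous_lam hb).pow 2).mul hf) t

lemma continuous_weightedPrimitive (hb : Continuous b) {f : ℝ → ℝ} (hf : Continuous f) :
    Continuous (weightedPrimitive b f) :=
  continuous_iff_continuousAt.2 fun t => (hasDerivAt_weightedPrimitive hb hf t).continuousAt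

lemma hasDerivAt_volterra (hb : Continuous b) {f : ℝ → ℝ} (hf : Continuous f) (t : ℝ) :
    HasDerivAt (volterra b f) ((lam b t ^ 2)⁻¹ * weightedPrimitive b f t) t :=
  hasDerivAt_integral_of_continuous
    ((continuous_lam_sq_inv hb).mul (continuous_weightedPrimitive hb hf)) t

lemma hasDerivAt_modeTerm_zero (hb : Continuous b) (a c t : ℝ) :
    HasDerivAt (modeTerm b a c 0) (c * (lam b t ^ 2)⁻¹) t :=
  ((hasDerivAt_integral_of_continuous (continuous_lam_sq_inv hb) t).const_mul c).const_add a

lemma continuous_modeTerm (hb : Continuous b) (a c : ℝ) (k : ℕ) :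
    Continuous (modeTerm b a c k) := by
  induction k with
  | zero =>
    exact continuous_iff_continuousAt.2 fun t => (hasDerivAt_modeTerm_zero hb a c t).continuousAt
  | succ k ih =>
    exact continuous_iff_continuousAt.2 fun t => (hasDerivAt_volterra hb ih t).continuousAt

lemma abs_integral_le_of_abs_le_pow {f : ℝ → ℝ} {K T : ℝ} {k : ℕ}
    (h : ∀ s, |s| ≤ T → |f s| ≤ K * |s| ^ k) {t : ℝ} (ht : |t| ≤ T) :
    |∫ s in (0 : ℝ)..t, f s| ≤ K * |t| ^ (k + 1) / (k + 1) := by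
  -- negative times are reduced to positive ones by reflection
  have key : ∀ g : ℝ → ℝ, (∀ s, |s| ≤ T → |g s| ≤ K * |s| ^ k) → ∀ t, 0 ≤ t → t ≤ T →
      |∫ s in (0 : ℝ)..t, g s| ≤ K * |t| ^ (k + 1) / (k + 1) := by
    intro g hg t ht htT
    have h1 : ‖∫ s in (0 : ℝ)..t, g s‖ ≤ ∫ s in (0 : ℝ)..t, K * s ^ k := by
      refine intervalIntegral.norm_integral_le_of_norm_le ht (ae_of_all _ fun s hs => ?_)
        ((by fun_prop : Continuous fun s : ℝ => K * s ^ k).intervalIntegrable _ _)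
      have := hg s (by rw [abs_of_pos hs.1]; exact hs.2.trans htT)
      rwa [abs_of_pos hs.1] at this
    rw [Real.norm_eq_abs] at h1
    refine h1.trans_eq ?_
    rw [intervalIntegral.integral_const_mul, integral_pow, abs_of_nonneg ht]
    simp
    ring
  rcases le_total 0 t with h0 | h0
  · exact key f h t h0 ((le_abs_self t).trans ht)
  · have h2 := key (fun s => f (-s)) (fun s hs => by
      simpa using h (-s) (by simpa using hs)) (-t) (by linarith) ((neg_le_abs t).trans ht)
    rw [intervalIntegral.integral_comp_neg (fun s => f s), neg_neg, neg_zero,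
      intervalIntegral.integral_symm, abs_neg, abs_neg] at h2
    exact h2

/-- On bounded time intervals the terms of the series of a mode decay factorially, since `λ²` and
`λ⁻²` are bounded there. The interval extends to negative times, because termwise differentiation
takes place on an open set containing `0`. -/
lemma exists_modeTerm_bound (hb : Continuous b) (a c T : ℝ) :
    ∃ K D : ℝ, ∀ k t, |t| ≤ T → |modeTerm b a c k t| ≤ D * (K ^ k / k.factorial) ∧
      |weightedPrimitive b (modeTerm b a c k) t| ≤ D * (K ^ k / k.factorial) := by
  obtain ⟨M, hM⟩ := (isCompact_Icc (a := -T) (b := T)).exists_bound_of_continuousOn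
    ((continuous_lam hb).pow 2).continuousOn
  obtain ⟨m, hm⟩ := (isCompact_Icc (a := -T) (b := T)).exists_bound_of_continuousOn
    (continuous_lam_sq_inv hb).continuousOn
  obtain ⟨D, hD⟩ := (isCompact_Icc (a := -T) (b := T)).exists_bound_of_continuousOn
    (continuous_modeTerm hb a c 0).continuousOn
  by_cases hT : T < 0
  · exact ⟨0, 0, fun k t ht => absurd (ht.trans_lt hT) (not_lt.2 (abs_nonneg t))⟩
  push Not at hT
  have h0 : (0 : ℝ) ∈ Icc (-T) T := ⟨by linarith, hT⟩
  have hM0 : 0 ≤ M := (norm_nonneg _).trans (hM 0 h0)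
  have hm0 : 0 ≤ m := (norm_nonneg _).trans (hm 0 h0)
  have hD0 : 0 ≤ D := (norm_nonneg _).trans (hD 0 h0)
  have prim : ∀ (f : ℝ → ℝ) (C : ℝ) (k : ℕ), 0 ≤ C → (∀ s, |s| ≤ T → |f s| ≤ C * |s| ^ k) →
      ∀ s, |s| ≤ T → |weightedPrimitive b f s| ≤ M * T * C * |s| ^ k := by
    intro f C k hC hf s hs
    have h1 : ‖∫ x in (0 : ℝ)..s, lam b x ^ 2 * f x‖ ≤ M * (C * |s| ^ k) * |s - 0| := by
      refine intervalIntegral.norm_integral_le_of_norm_le_const fun x hx => ?_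
      have hxs : |x| ≤ |s| := by
        rcases le_total 0 s with h | h
        · rw [uIoc_of_le h] at hx
          rw [abs_of_pos hx.1, abs_of_nonneg h]; exact hx.2
        · rw [uIoc_of_ge h] at hx
          rw [abs_of_nonpos hx.2, abs_of_nonpos h]; linarith [hx.1]
      rw [norm_mul]
      have h2 := hM x (abs_le.1 (hxs.trans hs))
      have h3 := hf x (hxs.trans hs)
      have h4 : |x| ^ k ≤ |s| ^ k := pow_le_pow_left₀ (abs_nonneg _) hxs k
      exact mul_le_mul h2 (h3.trans (mul_le_mul_of_nonneg_left h4 hC)) (norm_nonneg _) hM0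
    calc |weightedPrimitive b f s| ≤ M * (C * |s| ^ k) * |s - 0| := h1
      _ ≤ M * (C * |s| ^ k) * T := by
        rw [sub_zero]; exact mul_le_mul_of_nonneg_left hs (by positivity)
      _ = _ := by ring
  set K := m * (M * T) with hK
  have hK0 : 0 ≤ K := by positivity
  have main : ∀ k t, |t| ≤ T → |modeTerm b a c k t| ≤ D * (K ^ k / k.factorial) * |t| ^ k := by
    intro k
    induction k with
    | zero => intro t ht; simpa using hD t (abs_le.1 ht)
    | succ k ih =>
      intro t ht
      have h1 : ∀ s, |s| ≤ T → |(lam b s ^ 2)⁻¹ * weightedPrimitive b (modeTerm b a c k) s| ≤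
          (K * (D * (K ^ k / k.factorial))) * |s| ^ k := by
        intro s hs
        rw [abs_mul]
        calc _ ≤ m * (M * T * (D * (K ^ k / k.factorial)) * |s| ^ k) :=
              mul_le_mul (hm s (abs_le.1 hs)) (prim _ _ k (by positivity) ih s hs)
                (abs_nonneg _) hm0
          _ = _ := by rw [hK]; ring
      have h2 := abs_integral_le_of_abs_le_pow h1 ht
      refine h2.trans_eq ?_
      rw [Nat.factorial_succ]
      push_cast
      field_simp
      ring
  -- the factor `|t| ^ k ≤ T ^ k` is only needed for the induction and is absorbed into `K`
  refine ⟨K * T, max 1 (M * T) * D, fun k t ht => ⟨?_, ?_⟩⟩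
  · refine (main k t ht).trans ?_
    have h4 : |t| ^ k ≤ T ^ k := pow_le_pow_left₀ (abs_nonneg _) ht k
    calc _ ≤ 1 * (D * (K ^ k / k.factorial) * T ^ k) := by
          rw [one_mul]; exact mul_le_mul_of_nonneg_left h4 (by positivity)
      _ ≤ max 1 (M * T) * (D * (K ^ k / k.factorial) * T ^ k) :=
          mul_le_mul_of_nonneg_right (le_max_left _ _) (by positivity)
      _ = _ := by ring
  · refine (prim _ _ k (by positivity) (main k) t ht).trans ?_
    have h4 : |t| ^ k ≤ T ^ k := pow_le_pow_left₀ (abs_nonneg _) ht k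
    calc _ = M * T * (D * (K ^ k / k.factorial) * |t| ^ k) := by ring
      _ ≤ M * T * (D * (K ^ k / k.factorial) * T ^ k) := by gcongr
      _ ≤ max 1 (M * T) * (D * (K ^ k / k.factorial) * T ^ k) :=
          mul_le_mul_of_nonneg_right (le_max_right _ _) (by positivity)
      _ = _ := by ring

lemma summable_pow_mul_factorial (x K D : ℝ) :
    Summable fun k : ℕ => |x| ^ k * (D * (K ^ k / k.factorial)) := by
  refine ((Real.summable_pow_div_factorial (|x| * K)).mul_left D).congr fun k => ?_
  rw [mul_pow]; ring

lemma summable_mode (hb : Continuous b) (a c r t : ℝ) :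
    Summable fun k => (-r ^ 2) ^ k * modeTerm b a c k t := by
  obtain ⟨K, D, h⟩ := exists_modeTerm_bound hb a c |t|
  refine Summable.of_norm_bounded (summable_pow_mul_factorial (-r ^ 2) K D) fun k => ?_
  rw [norm_mul, norm_pow]
  exact mul_le_mul_of_nonneg_left (h k t le_rfl).1 (by positivity)

lemma summable_modeDeriv (hb : Continuous b) (a c r t : ℝ) :
    Summable fun k => (-r ^ 2) ^ (k + 1) * weightedPrimitive b (modeTerm b a c k) t := by
  obtain ⟨K, D, h⟩ := exists_modeTerm_bound hb a c |t|
  refine Summable.of_norm_bounded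
    ((summable_pow_mul_factorial (-r ^ 2) K D).mul_left |-r ^ 2|) fun k => ?_
  rw [norm_mul, norm_pow, Real.norm_eq_abs, Real.norm_eq_abs, pow_succ', mul_assoc]
  gcongr
  exact (h k t le_rfl).2

lemma hasDerivAt_mode (hb : Continuous b) (a c r t : ℝ) :
    HasDerivAt (mode b a c r) (modeDeriv b a c r t) t := by
  obtain ⟨K, D, h⟩ := exists_modeTerm_bound hb a c (|t| + 1)
  obtain ⟨m, hm⟩ := (isCompact_Icc (a := -(|t| + 1)) (b := |t| + 1)).exists_bound_of_continuousOn
    (continuous_lam_sq_inv hb).continuousOn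
  have hmem : ∀ y ∈ Ioo (-(|t| + 1)) (|t| + 1), |y| ≤ |t| + 1 := fun y hy => (abs_lt.2 hy).le
  have htI : t ∈ Ioo (-(|t| + 1)) (|t| + 1) := abs_lt.1 (lt_add_one _)
  -- the series without its first term is differentiated term by term
  have hser : HasDerivAt (fun s => ∑' k, (-r ^ 2) ^ (k + 1) * modeTerm b a c (k + 1) s)
      (∑' k, (-r ^ 2) ^ (k + 1) *
        ((lam b t ^ 2)⁻¹ * weightedPrimitive b (modeTerm b a c k) t)) t := by
    have hd : ∀ k y, HasDerivAt (fun s => (-r ^ 2) ^ (k + 1) * modeTerm b a c (k + 1) s)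
        ((-r ^ 2) ^ (k + 1) * ((lam b y ^ 2)⁻¹ * weightedPrimitive b (modeTerm b a c k) y)) y :=
      fun k y => HasDerivAt.const_mul ((-r ^ 2) ^ (k + 1))
        (hasDerivAt_volterra hb (continuous_modeTerm hb a c k) y)
    have hs0 : Summable fun k => (-r ^ 2) ^ (k + 1) * modeTerm b a c (k + 1) t :=
      (summable_nat_add_iff (f := fun k => (-r ^ 2) ^ k * modeTerm b a c k t) 1).2
        (summable_mode hb a c r t)
    refine hasDerivAt_tsum_of_isPreconnected
      ((summable_pow_mul_factorial (-r ^ 2) K D).mul_left (|-r ^ 2| * m))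
      isOpen_Ioo isPreconnected_Ioo
      (fun k y _ => hd k y) (fun k y hy => ?_) htI hs0 htI
    rw [norm_mul, norm_mul, norm_pow, pow_succ']
    have h1 := hm y (Ioo_subset_Icc_self hy)
    have h2 := (h k y (hmem y hy)).2
    have h3 : 0 ≤ m := (norm_nonneg _).trans h1
    calc _ ≤ |-r ^ 2| * |-r ^ 2| ^ k * (m * (D * (K ^ k / k.factorial))) := by
          refine mul_le_mul_of_nonneg_left (mul_le_mul h1 h2 (norm_nonneg _) h3) ?_
          positivity
      _ = _ := by ring
  have heq : mode b a c r = fun s => modeTerm b a c 0 s +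
      ∑' k, (-r ^ 2) ^ (k + 1) * modeTerm b a c (k + 1) s := by
    ext s
    rw [mode, (summable_mode hb a c r s).tsum_eq_zero_add]
    simp
  rw [heq]
  convert! (hasDerivAt_modeTerm_zero hb a c t).add hser using 1
  rw [modeDeriv, mul_add, mul_comm c, ← tsum_mul_left]
  congr 2
  ext k
  ring

lemma hasDerivAt_modeDeriv (hb : Continuous b) (a c r t : ℝ) :
    HasDerivAt (modeDeriv b a c r) (-(b t * modeDeriv b a c r t) - r ^ 2 * mode b a c r t) t := by
  obtain ⟨K, D, h⟩ := exists_modeTerm_bound hb a c (|t| + 1)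
  obtain ⟨m, hm⟩ := (isCompact_Icc (a := -(|t| + 1)) (b := |t| + 1)).exists_bound_of_continuousOn
    ((continuous_lam hb).pow 2).continuousOn
  have hmem : ∀ y ∈ Ioo (-(|t| + 1)) (|t| + 1), |y| ≤ |t| + 1 := fun y hy => (abs_lt.2 hy).le
  have htI : t ∈ Ioo (-(|t| + 1)) (|t| + 1) := abs_lt.1 (lt_add_one _)
  have hser : HasDerivAt
      (fun s => ∑' k, (-r ^ 2) ^ (k + 1) * weightedPrimitive b (modeTerm b a c k) s)
      (∑' k, (-r ^ 2) ^ (k + 1) * (lam b t ^ 2 * modeTerm b a c k t)) t := by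
    have hd : ∀ k y, HasDerivAt
        (fun s => (-r ^ 2) ^ (k + 1) * weightedPrimitive b (modeTerm b a c k) s)
        ((-r ^ 2) ^ (k + 1) * (lam b y ^ 2 * modeTerm b a c k y)) y :=
      fun k y => HasDerivAt.const_mul ((-r ^ 2) ^ (k + 1))
        (hasDerivAt_weightedPrimitive hb (continuous_modeTerm hb a c k) y)
    refine hasDerivAt_tsum_of_isPreconnected
      ((summable_pow_mul_factorial (-r ^ 2) K D).mul_left (|-r ^ 2| * m))
      isOpen_Ioo isPreconnected_Ioo
      (fun k y _ => hd k y) (fun k y hy => ?_) htI (summable_modeDeriv hb a c r t) htI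
    rw [norm_mul, norm_mul, norm_pow, pow_succ']
    have h1 := hm y (Ioo_subset_Icc_self hy)
    have h2 := (h k y (hmem y hy)).1
    have h3 : 0 ≤ m := (norm_nonneg _).trans h1
    calc _ ≤ |-r ^ 2| * |-r ^ 2| ^ k * (m * (D * (K ^ k / k.factorial))) := by
          refine mul_le_mul_of_nonneg_left (mul_le_mul h1 h2 (norm_nonneg _) h3) ?_
          positivity
      _ = _ := by ring
  have hsum : ∑' k, (-r ^ 2) ^ (k + 1) * (lam b t ^ 2 * modeTerm b a c k t) =
      -r ^ 2 * lam b t ^ 2 * mode b a c r t := by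
    rw [mode, ← tsum_mul_left]
    congr 1
    ext k
    ring
  have hl := (pow_pos (lam_pos b t) 2).ne'
  have := ((hasDerivAt_lam_sq hb t).fun_inv hl).mul (hser.const_add c)
  rw [hsum] at this
  unfold modeDeriv
  convert! this using 1
  have := (lam_pos b t).ne'
  field_simp
  ring

lemma isMode_mode (hb : Continuous b) (a c r : ℝ) :
    IsMode b r (mode b a c r) (modeDeriv b a c r) where
  hasDeriv t _ := (hasDerivAt_mode hb a c r t).hasDerivWithinAt
  hasDeriv' t _ := (hasDerivAt_modeDeriv hb a c r t).hasDerivWithinAt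

lemma mode_zero_time (a c r : ℝ) : mode b a c r 0 = a := by
  have h : ∀ k, k ≠ 0 → (-r ^ 2) ^ k * modeTerm b a c k 0 = 0 := by
    intro k hk
    obtain ⟨j, rfl⟩ := Nat.exists_eq_succ_of_ne_zero hk
    simp [modeTerm, volterra]
  rw [mode, tsum_eq_single 0 h]
  simp [modeTerm]

lemma modeDeriv_zero_time (a c r : ℝ) : modeDeriv b a c r 0 = c := by
  simp [modeDeriv, weightedPrimitive, lam_zero]

lemma measurable_mode (hb : Continuous b) (a c t : ℝ) : Measurable fun r => mode b a c r t := by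
  refine measurable_of_tendsto_metrizable (f := fun N r =>
    ∑ k ∈ Finset.range N, (-r ^ 2) ^ k * modeTerm b a c k t) (fun N => by fun_prop) ?_
  exact tendsto_pi_nhds.2 fun r => (summable_mode hb a c r t).hasSum.tendsto_sum_nat

lemma measurable_modeDeriv (hb : Continuous b) (a c t : ℝ) :
    Measurable fun r => modeDeriv b a c r t := by
  refine Measurable.const_mul (Measurable.const_add ?_ c) _
  refine measurable_of_tendsto_metrizable (f := fun N r =>
    ∑ k ∈ Finset.range N, (-r ^ 2) ^ (k + 1) * weightedPrimitive b (modeTerm b a c k) t)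
    (fun N => by fun_prop) ?_
  exact tendsto_pi_nhds.2 fun r => (summable_modeDeriv hb a c r t).hasSum.tendsto_sum_nat

end Construction

/-! ### Energy estimates at a fixed frequency -/

lemma antitoneOn_Ici_of_hasDerivWithinAt_nonpos {f f' : ℝ → ℝ} {T : ℝ}
    (h : ∀ t ≥ T, HasDerivWithinAt f (f' t) (Ici T) t) (h' : ∀ t ≥ T, f' t ≤ 0) :
    AntitoneOn f (Ici T) := by
  refine antitoneOn_of_deriv_nonpos (convex_Ici T) (fun t ht => (h t ht).continuousWithinAt)
    (fun t ht => ?_) fun t ht => ?_ <;> rw [interior_Ici] at ht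
  · exact ((h t ht.le).hasDerivAt (Ici_mem_nhds ht)).differentiableAt.differentiableWithinAt
  · rw [((h t ht.le).hasDerivAt (Ici_mem_nhds ht)).deriv]
    exact h' t ht.le

section Estimates

variable {b b' : ℝ → ℝ} {r : ℝ} {v v' : ℝ → ℝ}

lemma IsMode.hasDeriv_energy (h : IsMode b r v v') {t : ℝ} (ht : 0 ≤ t) :
    HasDerivWithinAt (fun s => r ^ 2 * v s ^ 2 + v' s ^ 2) (-(2 * b t * v' t ^ 2)) (Ici 0) t := by
  convert! (((h.hasDeriv t ht).pow 2).const_mul (r ^ 2)).add ((h.hasDeriv' t ht).pow 2) using 1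
  simp
  ring

lemma IsMode.energy_le (h : IsMode b r v v') (h0 : ∀ t, 0 ≤ b t) {t : ℝ} (ht : 0 ≤ t) :
    r ^ 2 * v t ^ 2 + v' t ^ 2 ≤ r ^ 2 * v 0 ^ 2 + v' 0 ^ 2 :=
  antitoneOn_Ici_of_hasDerivWithinAt_nonpos (fun t ht => h.hasDeriv_energy ht)
    (fun t _ => by
      have := h0 t
      have : 0 ≤ 2 * b t * v' t ^ 2 := by positivity
      linarith) self_mem_Ici ht ht

/-- The energy of `w = λ v`, which solves `w'' + (r² - b²/4 - b'/2) w = 0`. -/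
noncomputable def weightedEnergy (b : ℝ → ℝ) (r : ℝ) (v v' : ℝ → ℝ) (t : ℝ) : ℝ :=
  lam b t ^ 2 * (r ^ 2 * v t ^ 2 + (v' t + b t / 2 * v t) ^ 2)

lemma IsMode.hasDeriv_weightedEnergy (h : IsMode b r v v') (hb : Continuous b)
    (hb' : ∀ t ≥ 0, HasDerivWithinAt b (b' t) (Ici 0) t) {t : ℝ} (ht : 0 ≤ t) :
    HasDerivWithinAt (weightedEnergy b r v v')
      (lam b t ^ 2 * (2 * (b t ^ 2 / 4 + b' t / 2) * ((v' t + b t / 2 * v t) * v t))) (Ici 0) t := by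
  have h1 := h.hasDeriv t ht
  have h2 := (h.hasDeriv' t ht).add (((hb' t ht).div_const 2).mul h1)
  convert! (hasDerivAt_lam_sq hb t).hasDerivWithinAt.mul
    (((h1.pow 2).const_mul (r ^ 2)).add (h2.pow 2)) using 1
  simp
  ring

/-- In the hyperbolic zone, where `r (1 + t)` is bounded below, `λ v` has essentially conserved
energy, because its potential `b²/4 + b'/2` is `O((1 + t)⁻²)` and hence integrable with integral
`O(r)`. -/
lemma IsMode.weightedEnergy_bounds (h : IsMode b r v v') (hb : Continuous b)
    (hb' : ∀ t ≥ 0, HasDerivWithinAt b (b' t) (Ici 0) t) (hr : 0 < r) {P : ℝ}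
    (hP : ∀ t ≥ 0, |b t ^ 2 / 4 + b' t / 2| ≤ P / (1 + t) ^ 2) {T t : ℝ} (hT : 0 ≤ T)
    (ht : T ≤ t) :
    weightedEnergy b r v v' t ≤
        Real.exp (P / (r * (1 + T))) * weightedEnergy b r v v' T ∧
      weightedEnergy b r v v' T ≤
        Real.exp (P / (r * (1 + T))) * weightedEnergy b r v v' t := by
  have hP0 : 0 ≤ P := by simpa using (abs_nonneg _).trans (hP 0 le_rfl)
  set W := weightedEnergy b r v v'
  set p := fun t => b t ^ 2 / 4 + b' t / 2
  have hW0 : ∀ t, 0 ≤ W t := fun t => by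
    simp only [W, weightedEnergy]; positivity
  have hexp : ∀ (ε : ℝ) (t : ℝ), 0 ≤ t → HasDerivAt
      (fun s => Real.exp (ε * (P / (r * (1 + s)))))
      (Real.exp (ε * (P / (r * (1 + t)))) * (-ε * (P / r / (1 + t) ^ 2))) t := by
    intro ε t ht
    have h1 : r * (1 + t) ≠ 0 := by positivity
    have h2 := ((((((hasDerivAt_id t).const_add 1).const_mul r).fun_inv h1).const_mul
      P).const_mul ε).exp
    simp only [id, ← div_eq_mul_inv] at h2
    convert! h2 using 1
    field_simp
  -- `|2 w w'| ≤ (r² w² + w'²) / r` turns the bound on the potential into a bound on `W' / W`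
  set W' := fun t => lam b t ^ 2 * (2 * (b t ^ 2 / 4 + b' t / 2) * ((v' t + b t / 2 * v t) * v t))
  have hW' : ∀ t ≥ 0, |W' t| ≤ P / r / (1 + t) ^ 2 * W t := by
    intro t ht
    have h2 : 2 * |(v' t + b t / 2 * v t) * v t| * r ≤
        r ^ 2 * v t ^ 2 + (v' t + b t / 2 * v t) ^ 2 := by
      rw [abs_mul]
      have := two_mul_le_add_sq (r * |v t|) |v' t + b t / 2 * v t|
      simp only [mul_pow, sq_abs] at this
      linarith
    simp only [W', W, weightedEnergy]
    rw [abs_mul, abs_of_pos (pow_pos (lam_pos b t) 2),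
      mul_left_comm (P / r / (1 + t) ^ 2)]
    refine mul_le_mul_of_nonneg_left ?_ (pow_pos (lam_pos b t) 2).le
    rw [abs_mul, abs_mul, abs_two]
    calc _ = |b t ^ 2 / 4 + b' t / 2| *
          (2 * |(v' t + b t / 2 * v t) * v t| * r) / r := by field_simp
      _ ≤ P / (1 + t) ^ 2 * (r ^ 2 * v t ^ 2 + (v' t + b t / 2 * v t) ^ 2) / r := by
          have := hP t ht
          gcongr
      _ = _ := by ring
  have hd : ∀ t ≥ 0, HasDerivWithinAt W (W' t) (Ici 0) t := fun t ht =>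
    h.hasDeriv_weightedEnergy hb hb' ht
  -- `P / (r (1 + t))` is a primitive of `-P / (r (1 + t)²)`
  have hupper : AntitoneOn (fun s => Real.exp (1 * (P / (r * (1 + s)))) * W s) (Ici 0) := by
    refine antitoneOn_Ici_of_hasDerivWithinAt_nonpos
      (fun t ht => (hexp 1 t ht).hasDerivWithinAt.mul (hd t ht)) fun t ht => ?_
    have h1 := (abs_le.1 (hW' t ht)).2
    have h2 := Real.exp_pos (1 * (P / (r * (1 + t))))
    nlinarith
  have hlower : AntitoneOn (fun s => -(Real.exp (-1 * (P / (r * (1 + s)))) * W s)) (Ici 0) := by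
    refine antitoneOn_Ici_of_hasDerivWithinAt_nonpos
      (fun t ht => ((hexp (-1) t ht).hasDerivWithinAt.mul (hd t ht)).fun_neg) fun t ht => ?_
    have h1 := (abs_le.1 (hW' t ht)).1
    have h2 := Real.exp_pos (-1 * (P / (r * (1 + t))))
    nlinarith
  have ht0 : 0 ≤ t := hT.trans ht
  have hq : 0 ≤ P / (r * (1 + t)) := by positivity
  constructor
  · have h1 := hupper hT ht0 ht
    simp only [one_mul] at h1
    exact (le_mul_of_one_le_left (hW0 t) (Real.one_le_exp hq)).trans h1
  · have h1 := hlower hT ht0 ht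
    simp only [neg_mul, one_mul, neg_le_neg_iff] at h1
    have h2 : Real.exp (-(P / (r * (1 + t)))) * W t ≤ W t :=
      mul_le_of_le_one_left (hW0 t) (Real.exp_le_one_iff.2 (by linarith))
    have h3 := h1.trans h2
    rw [Real.exp_neg, inv_mul_le_iff₀ (Real.exp_pos _)] at h3
    exact h3

/-- All that the estimates use of the coefficient `b` and its derivative `b'`. The last two bounds
express that the dissipation is not effective. The coefficient is taken continuous and nonnegative
on all of `ℝ`, so that `λ` is differentiable and monotone everywhere. -/
structure IsNoneffective (b b' : ℝ → ℝ) (A B : ℝ) : Prop where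
  continuous : Continuous b
  nonneg : ∀ t, 0 ≤ b t
  hasDeriv : ∀ t ≥ 0, HasDerivWithinAt b (b' t) (Ici 0) t
  le : ∀ t ≥ 0, b t ≤ B / (1 + t)
  deriv_le : ∀ t ≥ 0, |b' t| ≤ B / (1 + t) ^ 2
  one_le : 1 ≤ A
  lam_le : ∀ t ≥ 0, lam b t ≤ A * (1 + t)
  integral_le : ∀ t ≥ 0, ∫ s in (0 : ℝ)..t, (lam b s)⁻¹ ≤ A * (1 + t) / lam b t

variable {A B : ℝ}

lemma IsNoneffective.potential_le (H : IsNoneffective b b' A B) {t : ℝ} (ht : 0 ≤ t) :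
    |b t ^ 2 / 4 + b' t / 2| ≤ (B ^ 2 / 4 + B / 2) / (1 + t) ^ 2 := by
  have h1 : b t ^ 2 ≤ B ^ 2 / (1 + t) ^ 2 := by
    rw [← div_pow]
    exact pow_le_pow_left₀ (H.nonneg t) (H.le t ht) 2
  have h2 := abs_le.1 (H.deriv_le t ht)
  have h3 := sq_nonneg (b t)
  have h4 : (B ^ 2 / 4 + B / 2) / (1 + t) ^ 2 =
      B ^ 2 / (1 + t) ^ 2 / 4 + B / (1 + t) ^ 2 / 2 := by ring
  rw [h4, abs_le]
  constructor <;> linarith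

/-- Where `r (1 + t) ≥ 1 / N`, the energy of `v` is comparable with `λ⁻²` times the energy of `λ v`,
because `b ≤ B N r`. -/
lemma IsNoneffective.energy_comparable (H : IsNoneffective b b' A B) {N t x y : ℝ}
    (ht : 0 ≤ t) (hN : 1 ≤ N * (r * (1 + t))) :
    r ^ 2 * x ^ 2 + y ^ 2 ≤
        (2 + (B * N) ^ 2) * (r ^ 2 * x ^ 2 + (y + b t / 2 * x) ^ 2) ∧
      r ^ 2 * x ^ 2 + (y + b t / 2 * x) ^ 2 ≤
        (2 + (B * N) ^ 2) * (r ^ 2 * x ^ 2 + y ^ 2) := by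
  have hB : 0 ≤ B := by simpa using (H.nonneg 0).trans (H.le 0 le_rfl)
  have hτ : 0 < 1 + t := by linarith
  have h1 : b t ≤ B * N * r := by
    refine (H.le t ht).trans ?_
    rw [div_le_iff₀ hτ]
    nlinarith
  have h2 : (b t * x) ^ 2 ≤ (B * N) ^ 2 * (r ^ 2 * x ^ 2) := by
    rw [mul_pow (b t), ← mul_assoc, ← mul_pow (B * N)]
    exact mul_le_mul_of_nonneg_right (pow_le_pow_left₀ (H.nonneg t) h1 2) (sq_nonneg _)
  have h3 : 0 ≤ (B * N) ^ 2 := sq_nonneg _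
  constructor
  · nlinarith [sq_nonneg (y + b t * x), sq_nonneg (r * x),
      mul_nonneg h3 (sq_nonneg (y + b t / 2 * x))]
  · nlinarith [sq_nonneg (y - b t / 2 * x), sq_nonneg (r * x), mul_nonneg h3 (sq_nonneg y)]

lemma IsNoneffective.hyperbolic_bounds (H : IsNoneffective b b' A B) {N : ℝ} (hN : 0 ≤ N) :
    ∃ C > 0, ∀ (r : ℝ) (v v' : ℝ → ℝ) (T t : ℝ), 0 < r → IsMode b r v v' → 0 ≤ T → T ≤ t →
      1 ≤ N * (r * (1 + T)) →
      lam b t ^ 2 * (r ^ 2 * v t ^ 2 + v' t ^ 2) ≤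
          C * (lam b T ^ 2 * (r ^ 2 * v T ^ 2 + v' T ^ 2)) ∧
        lam b T ^ 2 * (r ^ 2 * v T ^ 2 + v' T ^ 2) ≤
          C * (lam b t ^ 2 * (r ^ 2 * v t ^ 2 + v' t ^ 2)) := by
  have hB : 0 ≤ B := by simpa using (H.nonneg 0).trans (H.le 0 le_rfl)
  set P := B ^ 2 / 4 + B / 2
  have hP : 0 ≤ P := by positivity
  set D := 2 + (B * N) ^ 2
  have hD : 0 < D := by positivity
  refine ⟨D * (Real.exp (P * N) * D), by positivity, fun r v v' T t hr h hT hTt hrT => ?_⟩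
  have hT' : 0 < 1 + T := by linarith
  have hrt : 1 ≤ N * (r * (1 + t)) := hrT.trans (by gcongr)
  obtain ⟨h1, h2⟩ := h.weightedEnergy_bounds H.continuous H.hasDeriv hr
    (fun t ht => H.potential_le ht) hT hTt
  have hexp : Real.exp (P / (r * (1 + T))) ≤ Real.exp (P * N) := by
    refine Real.exp_le_exp.2 ((div_le_iff₀ (by positivity)).2 ?_)
    nlinarith
  obtain ⟨ht1, ht2⟩ := H.energy_comparable (x := v t) (y := v' t) (hT.trans hTt) hrt
  obtain ⟨hT1, hT2⟩ := H.energy_comparable (x := v T) (y := v' T) hT hrT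
  have conv : ∀ {s x y : ℝ}, x ≤ D * y → lam b s ^ 2 * x ≤ D * (lam b s ^ 2 * y) := by
    intro s x y hxy
    rw [mul_left_comm]
    exact mul_le_mul_of_nonneg_left hxy (sq_nonneg _)
  have hW0 : ∀ s, 0 ≤ weightedEnergy b r v v' s := fun s => by
    unfold weightedEnergy; positivity
  constructor
  · calc _ ≤ D * weightedEnergy b r v v' t := conv ht1
      _ ≤ D * (Real.exp (P * N) * weightedEnergy b r v v' T) :=
        mul_le_mul_of_nonneg_left
          (h1.trans (mul_le_mul_of_nonneg_right hexp (hW0 T))) hD.le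
      _ ≤ D * (Real.exp (P * N) * (D * (lam b T ^ 2 * (r ^ 2 * v T ^ 2 + v' T ^ 2)))) := by
        have := conv (s := T) hT2
        unfold weightedEnergy
        gcongr
      _ = _ := by ring
  · calc _ ≤ D * weightedEnergy b r v v' T := conv hT1
      _ ≤ D * (Real.exp (P * N) * weightedEnergy b r v v' t) :=
        mul_le_mul_of_nonneg_left
          (h2.trans (mul_le_mul_of_nonneg_right hexp (hW0 t))) hD.le
      _ ≤ D * (Real.exp (P * N) * (D * (lam b t ^ 2 * (r ^ 2 * v t ^ 2 + v' t ^ 2)))) := by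
        have := conv (s := t) ht2
        unfold weightedEnergy
        gcongr
      _ = _ := by ring

/-- In the dissipative zone `2 A r (1 + T) ≤ 1` the term `r² v` is a perturbation: the maximum `M`
of `λ |v'|` bounds `|v|` by `|v(0)| + M ∫ λ⁻¹`, and inserting this into `(λ² v')' = -r² λ² v`
returns a bound for `M` with a small factor in front of `M`. -/
lemma IsNoneffective.dissipative_bound (H : IsNoneffective b b' A B) (hr : 0 ≤ r)
    (h : IsMode b r v v') {T : ℝ} (hT : 0 ≤ T) (hrT : 2 * A * (r * (1 + T)) ≤ 1) :
    lam b T ^ 2 * (r ^ 2 * v T ^ 2 + v' T ^ 2) ≤ 13 * (v 0 ^ 2 + v' 0 ^ 2) := by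
  have hA := H.one_le
  have hb := H.continuous
  have hmono := monotone_lam hb H.nonneg
  have hv'c : ContinuousOn v' (Icc 0 T) := fun t ht =>
    (h.hasDeriv' t ht.1).continuousWithinAt.mono Icc_subset_Ici_self
  obtain ⟨s₀, hs₀, hmax⟩ := isCompact_Icc.exists_isMaxOn (nonempty_Icc.2 hT)
    ((continuous_lam hb).continuousOn.mul hv'c.abs)
  set M := lam b s₀ * |v' s₀|
  have hM : ∀ s ∈ Icc 0 T, lam b s * |v' s| ≤ M := fun s hs => hmax hs
  have hM0 : 0 ≤ M := mul_nonneg (lam_pos b _).le (abs_nonneg _)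
  have hv : ∀ s ∈ Icc 0 T, |v s| ≤ |v 0| + M * (A * (1 + s) / lam b s) := by
    intro s hs
    have hinv : Continuous fun s => (lam b s)⁻¹ :=
      (continuous_lam hb).inv₀ fun t => (lam_pos b t).ne'
    have hbound := image_norm_le_of_norm_deriv_right_le_deriv_boundary' (a := 0) (b := s)
      (f := v) (f' := v') (B := fun x => |v 0| + M * ∫ s in (0 : ℝ)..x, (lam b s)⁻¹)
      (B' := fun x => M * (lam b x)⁻¹)
      (fun t ht => (h.hasDeriv t ht.1).continuousWithinAt.mono Icc_subset_Ici_self)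
      (fun t ht => (h.hasDeriv t ht.1).mono (Ici_subset_Ici.2 ht.1)) (by simp)
      (fun t _ => (((hasDerivAt_integral_of_continuous hinv t).const_mul M).const_add
        |v 0|).continuousAt.continuousWithinAt)
      (fun t _ => (((hasDerivAt_integral_of_continuous hinv t).const_mul M).const_add
        |v 0|).hasDerivWithinAt)
      (fun t ht => by
        rw [← div_eq_mul_inv, le_div_iff₀ (lam_pos b t), mul_comm]
        exact hM t ⟨ht.1, ht.2.le.trans hs.2⟩) (right_mem_Icc.2 hs.1)
    refine hbound.trans ?_
    have := H.integral_le s hs.1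
    gcongr
  have hrA : r * (1 + T) * A ≤ 1 / 2 := by linarith
  have hr1 : r * (1 + T) ≤ 1 / 2 := by nlinarith [mul_nonneg hr (by linarith : 0 ≤ 1 + T)]
  have hr0 : 0 ≤ r * (1 + T) := by positivity
  have hbound : ∀ t ∈ Icc 0 T, lam b t * |v' t| ≤ |v' 0| + (|v 0| + M) / 2 := by
    intro t ht
    have hl := lam_pos b t
    have hl1 := one_le_lam hb H.nonneg ht.1
    have hd : ∀ s ∈ Icc 0 t, HasDerivWithinAt (fun s => lam b s ^ 2 * v' s)
        (-(r ^ 2 * (lam b s ^ 2 * v s))) (Icc 0 t) s := by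
      intro s hs
      convert! ((hasDerivAt_lam_sq hb s).hasDerivWithinAt.mul (h.hasDeriv' s hs.1)).mono
        Icc_subset_Ici_self using 1
      ring
    have hle := (convex_Icc 0 t).norm_image_sub_le_of_norm_hasDerivWithin_le
      (C := r ^ 2 * (lam b t ^ 2 * |v 0| + M * (A * (1 + t)) * lam b t)) hd (fun s hs => by
        have hls := lam_pos b s
        have hlst := hmono hs.2
        have h1 : |v s| ≤ |v 0| + M * (A * (1 + s) / lam b s) := hv s ⟨hs.1, hs.2.trans ht.2⟩
        have hs0 := hs.1
        have hst := hs.2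
        have hMA : 0 ≤ M * (A * (1 + t)) := by have := ht.1; positivity
        rw [norm_neg, norm_mul, norm_mul, Real.norm_eq_abs, Real.norm_eq_abs, Real.norm_eq_abs,
          abs_of_nonneg (sq_nonneg r), abs_of_pos (pow_pos hls 2)]
        calc r ^ 2 * (lam b s ^ 2 * |v s|)
            ≤ r ^ 2 * (lam b s ^ 2 * (|v 0| + M * (A * (1 + s) / lam b s))) := by gcongr
          _ = r ^ 2 * (lam b s ^ 2 * |v 0| + M * (A * (1 + s)) * lam b s) := by
            field_simp
          _ ≤ _ := by gcongr) (left_mem_Icc.2 ht.1) (right_mem_Icc.2 ht.1)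
    simp only [lam_zero, one_pow, one_mul, sub_zero, Real.norm_eq_abs, abs_of_nonneg ht.1] at hle
    have h2 : lam b t ^ 2 * |v' t| ≤
        |v' 0| + r ^ 2 * (lam b t ^ 2 * |v 0| + M * (A * (1 + t)) * lam b t) * t := by
      have h3 := abs_sub_abs_le_abs_sub (lam b t ^ 2 * v' t) (v' 0)
      rw [abs_mul, abs_of_pos (pow_pos hl 2)] at h3
      linarith
    have ht0 := ht.1
    have htT := ht.2
    have h4 : r ^ 2 * (lam b t ^ 2 * |v 0| + M * (A * (1 + t)) * lam b t) * t ≤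
        lam b t * ((|v 0| + M) / 2) := by
      calc _ = lam b t * (r ^ 2 * t * (lam b t * |v 0| + M * (A * (1 + t)))) := by ring
        _ ≤ lam b t * (r ^ 2 * (1 + T) * ((A * (1 + T)) * |v 0| + M * (A * (1 + T)))) := by
          have : lam b t ≤ A * (1 + T) := (H.lam_le t ht0).trans (by gcongr)
          have : t ≤ 1 + T := by linarith
          gcongr
        _ = lam b t * ((r * (1 + T)) * (r * (1 + T) * A) * (|v 0| + M)) := by ring
        _ ≤ lam b t * ((1 / 2) * 1 * (|v 0| + M)) := by
          have : r * (1 + T) * A ≤ 1 := by linarith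
          gcongr
        _ = _ := by ring
    have h5 : lam b t * (lam b t * |v' t|) ≤ lam b t * (|v' 0| + (|v 0| + M) / 2) := by
      nlinarith [abs_nonneg (v' 0)]
    exact le_of_mul_le_mul_left h5 hl
  -- at the point where the maximum is attained, half of `M` is absorbed into the left hand side
  have hM2 : M ≤ 2 * |v' 0| + |v 0| := by
    have := hbound s₀ hs₀
    change M ≤ _ at this
    linarith
  have hTm : T ∈ Icc 0 T := right_mem_Icc.2 hT
  have e1 : lam b T * |v' T| ≤ 2 * |v' 0| + |v 0| := (hM T hTm).trans hM2
  have e2 : lam b T * (r * |v T|) ≤ |v' 0| + |v 0| := by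
    have hl := lam_pos b T
    calc lam b T * (r * |v T|)
        ≤ lam b T * (r * (|v 0| + M * (A * (1 + T) / lam b T))) := by
          have := hv T hTm
          gcongr
      _ = r * lam b T * |v 0| + r * (1 + T) * A * M := by field_simp
      _ ≤ r * (A * (1 + T)) * |v 0| + 1 / 2 * M := by
          have := H.lam_le T hT
          gcongr
      _ ≤ 1 / 2 * |v 0| + 1 / 2 * M := by
          have : r * (A * (1 + T)) ≤ 1 / 2 := by linarith
          gcongr
      _ ≤ _ := by linarith
  have hl := lam_pos b T
  have e1' := pow_le_pow_left₀ (by positivity) e1 2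
  have e2' := pow_le_pow_left₀ (by positivity) e2 2
  simp only [mul_pow, sq_abs] at e1' e2'
  nlinarith [sq_nonneg (|v' 0| - |v 0|), sq_abs (v 0), sq_abs (v' 0)]

/-- The upper bound at all frequencies and times. Beyond the dissipative zone it follows from the
hyperbolic estimate started on the boundary of the two zones, or at time `0`. -/
lemma IsNoneffective.exists_upper_bound (H : IsNoneffective b b' A B) :
    ∃ C > 0, ∀ (r : ℝ) (v v' : ℝ → ℝ) (t : ℝ), 0 ≤ r → IsMode b r v v' → 0 ≤ t →
      lam b t ^ 2 * (r ^ 2 * v t ^ 2 + v' t ^ 2) ≤ C * ((1 + r ^ 2) * v 0 ^ 2 + v' 0 ^ 2) := by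
  have hA := H.one_le
  obtain ⟨C, hC, hyp⟩ := H.hyperbolic_bounds (N := 2 * A) (by linarith)
  refine ⟨13 * (C + 1), by positivity, fun r v v' t hr h ht => ?_⟩
  have hrv := mul_nonneg (sq_nonneg r) (sq_nonneg (v 0))
  have hd0 := sq_nonneg (v 0)
  have hd1 := sq_nonneg (v' 0)
  rcases le_total (2 * A * (r * (1 + t))) 1 with h1 | h1
  · refine (H.dissipative_bound hr h ht h1).trans ?_
    nlinarith
  · have hr' : 0 < r := by
      rcases hr.eq_or_lt with h2 | h2
      · rw [← h2] at h1; norm_num at h1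
      · exact h2
    rcases le_total 1 (2 * A * r) with h2 | h2
    · have h3 := (hyp r v v' 0 t hr' h le_rfl ht (by linarith)).1
      rw [lam_zero, one_pow, one_mul] at h3
      refine h3.trans ?_
      nlinarith
    · -- the time at which the frequency `r` leaves the dissipative zone
      have h4 : (0 : ℝ) < 2 * A * r := by positivity
      have hT : 0 ≤ 1 / (2 * A * r) - 1 := by
        rw [sub_nonneg, le_div_iff₀ h4]; linarith
      have hTt : 1 / (2 * A * r) - 1 ≤ t := by
        rw [sub_le_iff_le_add, div_le_iff₀ h4]; linarith
      have heq : 2 * A * (r * (1 + (1 / (2 * A * r) - 1))) = 1 := by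
        field_simp
        ring
      refine (hyp r v v' _ t hr' h hT hTt heq.ge).1.trans ?_
      have h5 := H.dissipative_bound hr h hT heq.le
      calc _ ≤ C * (13 * (v 0 ^ 2 + v' 0 ^ 2)) := mul_le_mul_of_nonneg_left h5 hC.le
        _ ≤ _ := by nlinarith

lemma IsNoneffective.exists_lower_bound (H : IsNoneffective b b' A B) :
    ∃ c > 0, ∀ (r : ℝ) (v v' : ℝ → ℝ) (t : ℝ), 1 ≤ r → IsMode b r v v' → 0 ≤ t →
      c * (r ^ 2 * v 0 ^ 2 + v' 0 ^ 2) ≤ lam b t ^ 2 * (r ^ 2 * v t ^ 2 + v' t ^ 2) := by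
  obtain ⟨C, hC, hyp⟩ := H.hyperbolic_bounds (N := 1) zero_le_one
  refine ⟨C⁻¹, inv_pos.2 hC, fun r v v' t hr h ht => ?_⟩
  have h3 := (hyp r v v' 0 t (by linarith) h le_rfl ht (by linarith)).2
  rw [lam_zero, one_pow, one_mul] at h3
  rwa [inv_mul_le_iff₀ hC]

end Estimates

/-! ### Dissipation terms below the effective threshold -/

lemma lam_congr {b β : ℝ → ℝ} (h : EqOn b β (Ici 0)) {t : ℝ} (ht : 0 ≤ t) :
    lam b t = lam β t := by
  unfold lam
  rw [intervalIntegral.integral_congr (g := β)]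
  intro s hs
  rw [uIcc_of_le ht] at hs
  exact h hs.1

/-- Only `limsup t b(t) < 2` is needed: then `(1 + t) / λ(t)` has derivative at least `1 / (4 λ(t))`
for large `t`, and both bounds on `λ` follow by integration. -/
lemma exists_isNoneffective {b : ℝ → ℝ} (hsmooth : ContDiffOn ℝ ∞ b (Ici 0))
    (H1 : ∀ t ≥ 0, 0 ≤ b t)
    (H3 : ∃ C : ℝ, ∀ t ≥ 0,
      |iteratedDerivWithin 1 b (Ici 0) t| ≤ C * b t * (1 / (1 + t)) ^ 1)
    (NE : limsup (fun t : ℝ => ((t * b t : ℝ) : EReal)) atTop < 1) :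
    ∃ b' : ℝ → ℝ, ∃ A B : ℝ, IsNoneffective (fun t => b (max t 0)) b' A B := by
  set β : ℝ → ℝ := fun t => b (max t 0) with hβ
  have hEq : ∀ t ≥ 0, β t = b t := fun t ht => by simp only [hβ, max_eq_left ht]
  have hcont : Continuous β :=
    hsmooth.continuousOn.comp_continuous (by fun_prop) fun t => le_max_right t 0
  have hnn : ∀ t, 0 ≤ β t := fun t => H1 _ (le_max_right t 0)
  -- for `t ≥ 2`, `t b(t) ≤ 1` implies `(1 + t) b(t) ≤ 3 / 2`
  have hev := (eventually_lt_of_limsup_lt NE).and (eventually_ge_atTop (2 : ℝ))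
  obtain ⟨t₀, ht₀⟩ := eventually_atTop.1 hev
  have h2 : 2 ≤ t₀ := (ht₀ t₀ le_rfl).2
  have hlt : ∀ t ≥ t₀, t * β t ≤ 1 := fun t ht => by
    have := (ht₀ t ht).1
    rw [hEq t (by linarith)]
    exact_mod_cast this.le
  obtain ⟨M, hM⟩ := (isCompact_Icc (a := (0 : ℝ)) (b := t₀)).exists_bound_of_continuousOn
    hcont.continuousOn
  set B₁ := max 2 (M * (1 + t₀))
  have hle : ∀ t ≥ 0, β t ≤ B₁ / (1 + t) := by
    intro t ht
    rw [le_div_iff₀ (by linarith)]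
    rcases le_total t t₀ with h | h
    · refine le_trans ?_ (le_max_right _ _)
      have h3 := (le_abs_self _).trans (hM t ⟨ht, h⟩)
      exact mul_le_mul h3 (by linarith) (by linarith) ((hnn t).trans h3)
    · refine le_trans ?_ (le_max_left _ _)
      have := hlt t h
      nlinarith [hnn t]
  obtain ⟨C, hC⟩ := H3
  have hB₁ : 0 ≤ B₁ := zero_le_two.trans (le_max_left _ _)
  set τ := fun t : ℝ => (1 + t) / lam β t
  have hτ : ∀ t, HasDerivAt τ ((1 - β t * (1 + t) / 2) / lam β t) t := by
    intro t
    have h := ((hasDerivAt_id t).const_add 1).fun_div (hasDerivAt_lam hcont t) (lam_pos β t).ne'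
    convert! h using 1
    have := (lam_pos β t).ne'
    simp only [id]
    field_simp
  have hinv : Continuous fun s => (lam β s)⁻¹ :=
    (continuous_lam hcont).inv₀ fun t => (lam_pos β t).ne'
  have hτ' : ∀ t ≥ t₀, 1 / 4 * (lam β t)⁻¹ ≤ (1 - β t * (1 + t) / 2) / lam β t := by
    intro t ht
    rw [div_eq_mul_inv]
    refine mul_le_mul_of_nonneg_right ?_ (inv_pos.2 (lam_pos β t)).le
    have h3 := hlt t ht
    have : 2 * β t ≤ 1 := by nlinarith [hnn t]
    linarith
  have hint : AntitoneOn (fun t => (∫ s in (0 : ℝ)..t, (lam β s)⁻¹) - 4 * τ t) (Ici t₀) := by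
    refine antitoneOn_Ici_of_hasDerivWithinAt_nonpos (fun t _ =>
      ((hasDerivAt_integral_of_continuous hinv t).sub
        ((hτ t).const_mul 4)).hasDerivWithinAt) fun t ht => ?_
    linarith [hτ' t ht]
  have hτanti : AntitoneOn (fun t => -τ t) (Ici t₀) := by
    refine antitoneOn_Ici_of_hasDerivWithinAt_nonpos (fun t _ =>
      (hτ t).fun_neg.hasDerivWithinAt) fun t ht => ?_
    have h3 := inv_pos.2 (lam_pos β t)
    linarith [hτ' t ht]
  have hl₀ := lam_pos β t₀
  -- up to `t₀` the monotonicity of `λ` gives the bound, afterwards that of `τ`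
  have hτlow : ∀ t ≥ 0, 1 ≤ lam β t₀ * τ t := by
    intro t ht
    have hl := lam_pos β t
    rcases le_total t t₀ with h | h
    · have h3 := monotone_lam hcont hnn h
      have : 1 ≤ lam β t₀ / lam β t := (one_le_div hl).2 h3
      calc (1 : ℝ) ≤ lam β t₀ / lam β t * (1 + t) := by nlinarith
        _ = _ := by simp only [τ]; ring
    · have h3 : τ t₀ ≤ τ t := neg_le_neg_iff.1 (hτanti self_mem_Ici h h)
      have h4 : lam β t₀ * τ t₀ = 1 + t₀ := by simp only [τ]; field_simp
      nlinarith
  have hint_le : ∀ t ≥ 0, ∫ s in (0 : ℝ)..t, (lam β s)⁻¹ ≤ t := by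
    intro t ht
    calc ∫ s in (0 : ℝ)..t, (lam β s)⁻¹ ≤ ∫ s in (0 : ℝ)..t, (1 : ℝ) :=
          intervalIntegral.integral_mono_on ht (hinv.intervalIntegrable _ _) (by simp)
            fun s hs => inv_le_one_of_one_le₀ (one_le_lam hcont hnn hs.1)
      _ = t := by simp
  have hτpos : ∀ t ≥ 0, 0 ≤ τ t := fun t ht => by
    have := lam_pos β t
    simp only [τ]
    positivity
  refine ⟨derivWithin b (Ici 0), 4 + (t₀ + 1) * lam β t₀, max B₁ (|C| * B₁),
    hcont, hnn, fun t ht => ?_, fun t ht => ?_, fun t ht => ?_, ?_, fun t ht => ?_,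
    fun t ht => ?_⟩
  · exact ((hsmooth.differentiableOn (by simp)) t ht).hasDerivWithinAt.congr
      (fun s hs => hEq s hs) (hEq t ht)
  · refine (hle t ht).trans ?_
    gcongr
    exact le_max_left _ _
  · have h3 := hC t ht
    rw [iteratedDerivWithin_one, pow_one] at h3
    have h4 : C * b t ≤ |C| * (B₁ / (1 + t)) :=
      mul_le_mul (le_abs_self C) ((hEq t ht).symm.le.trans (hle t ht)) (H1 t ht) (abs_nonneg _)
    calc _ ≤ |C| * (B₁ / (1 + t)) * (1 / (1 + t)) := h3.trans (by gcongr)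
      _ = |C| * B₁ / (1 + t) ^ 2 := by field_simp
      _ ≤ _ := by
        gcongr
        exact le_max_right _ _
  · nlinarith
  · have hl := lam_pos β t
    have h3 := hτlow t ht
    have h4 : lam β t ≤ lam β t₀ * (1 + t) := by
      have : lam β t₀ * τ t = lam β t₀ * (1 + t) / lam β t := by simp only [τ]; ring
      rw [this, le_div_iff₀ hl] at h3
      linarith
    refine h4.trans ?_
    gcongr
    nlinarith
  · have h3 := hτlow t ht
    have h4 := hτpos t ht
    rw [mul_div_assoc]
    change _ ≤ (4 + (t₀ + 1) * lam β t₀) * τ t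
    have h5 : t₀ ≤ t₀ * (lam β t₀ * τ t) := le_mul_of_one_le_right (by linarith) h3
    rcases le_total t t₀ with h | h
    · have := hint_le t ht
      nlinarith
    · have h6 := hint self_mem_Ici h h
      simp only at h6
      have h7 := hint_le t₀ (by linarith)
      have h8 := hτpos t₀ (by linarith)
      nlinarith

/-! ### Multiplication operators on `L²` -/

variable {n : ℕ}

/-- Measurable functions with `|m| ≤ C`, the symbols of bounded multiplication operators. -/
def IsSymbol (C : ℝ) (m : EuclideanSpace ℝ (Fin n) → ℝ) : Prop :=
  Measurable m ∧ ∀ ξ, |m ξ| ≤ C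

lemma IsSymbol.memLp {C : ℝ} {m : EuclideanSpace ℝ (Fin n) → ℝ} (h : IsSymbol C m) (f : L2 n) :
    MemLp (fun ξ => (m ξ : ℂ) * f ξ) 2 := by
  refine MemLp.of_le_mul (c := C) (Lp.memLp f)
    ((Complex.measurable_ofReal.comp h.1).aestronglyMeasurable.mul
      (Lp.aestronglyMeasurable f)) (ae_of_all _ fun ξ => ?_)
  rw [norm_mul, Complex.norm_real]
  exact mul_le_mul_of_nonneg_right (h.2 ξ) (norm_nonneg _)

open Classical in
/-- Multiplication by the real function `m` on `L²`, if `m` is bounded and measurable; zero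
otherwise. -/
noncomputable def mulOp (m : EuclideanSpace ℝ (Fin n) → ℝ) : L2 n →L[ℂ] L2 n :=
  if h : ∃ C, IsSymbol C m then
    LinearMap.mkContinuousOfExistsBound
      { toFun := fun f => (h.choose_spec.memLp f).toLp _
        map_add' := fun f g => by
          rw [← MemLp.toLp_add]
          refine MemLp.toLp_congr _ _ ?_
          filter_upwards [Lp.coeFn_add f g] with ξ hξ
          rw [hξ, Pi.add_apply, Pi.add_apply, mul_add]
        map_smul' := fun c f => by
          rw [RingHom.id_apply, ← MemLp.toLp_const_smul]
          refine MemLp.toLp_congr _ _ ?_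
          filter_upwards [Lp.coeFn_smul c f] with ξ hξ
          rw [hξ, Pi.smul_apply, Pi.smul_apply, smul_eq_mul, smul_eq_mul, mul_left_comm] }
      ⟨h.choose, fun f => by
        refine Lp.norm_le_mul_norm_of_ae_le_mul ?_
        filter_upwards [(h.choose_spec.memLp f).coeFn_toLp] with ξ hξ
        simp only [LinearMap.coe_mk, AddHom.coe_mk]
        rw [hξ, norm_mul, Complex.norm_real]
        exact mul_le_mul_of_nonneg_right (h.choose_spec.2 ξ) (norm_nonneg _)⟩
  else 0

lemma IsSymbol.coeFn_mulOp {C : ℝ} {m : EuclideanSpace ℝ (Fin n) → ℝ} (h : IsSymbol C m)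
    (f : L2 n) : mulOp m f =ᵐ[volume] fun ξ => (m ξ : ℂ) * f ξ := by
  have h' : ∃ C, IsSymbol C m := ⟨C, h⟩
  rw [mulOp, dif_pos h']
  exact (h.memLp f).coeFn_toLp

lemma IsSymbol.norm_mulOp_le {C : ℝ} {m : EuclideanSpace ℝ (Fin n) → ℝ} (h : IsSymbol C m)
    (f : L2 n) : ‖mulOp m f‖ ≤ C * ‖f‖ := by
  refine Lp.norm_le_mul_norm_of_ae_le_mul ?_
  filter_upwards [h.coeFn_mulOp f] with ξ hξ
  rw [hξ, norm_mul, Complex.norm_real]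
  exact mul_le_mul_of_nonneg_right (h.2 ξ) (norm_nonneg _)

lemma L2.norm_sq_eq_integral (f : L2 n) : ‖f‖ ^ 2 = ∫ ξ, ‖f ξ‖ ^ 2 := by
  have h := L2.inner_def (𝕜 := ℂ) f f
  rw [inner_self_eq_norm_sq_to_K] at h
  simp only [inner_self_eq_norm_sq_to_K] at h
  have h2 : ((‖f‖ ^ 2 : ℝ) : ℂ) = ((∫ ξ, ‖f ξ‖ ^ 2 : ℝ) : ℂ) := by
    rw [← integral_complex_ofReal]
    push_cast
    exact h
  exact_mod_cast h2

lemma L2.integrable_norm_sq (f : L2 n) : Integrable fun ξ => ‖f ξ‖ ^ 2 :=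
  (Lp.memLp f).integrable_norm_pow two_ne_zero

/-- Bounded pointwise convergence of symbols implies strong convergence of the operators. -/
lemma tendsto_mulOp {ι : Type*} {l : Filter ι} [l.IsCountablyGenerated] {C : ℝ}
    {m : ι → EuclideanSpace ℝ (Fin n) → ℝ} {m₀ : EuclideanSpace ℝ (Fin n) → ℝ}
    (hm : ∀ᶠ i in l, IsSymbol C (m i)) (hm₀ : IsSymbol C m₀)
    (hlim : ∀ ξ, Tendsto (fun i => m i ξ) l (𝓝 (m₀ ξ))) (f : L2 n) :
    Tendsto (fun i => mulOp (m i) f) l (𝓝 (mulOp m₀ f)) := by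
  rw [tendsto_iff_norm_sub_tendsto_zero]
  have hsq : Tendsto (fun i => ∫ ξ, (m i ξ - m₀ ξ) ^ 2 * ‖f ξ‖ ^ 2) l (𝓝 0) := by
    have h0 : ∫ ξ, (0 : ℝ) * ‖f ξ‖ ^ 2 = 0 := by simp
    rw [← h0]
    refine tendsto_integral_filter_of_dominated_convergence (fun ξ => (2 * C) ^ 2 * ‖f ξ‖ ^ 2)
      ?_ ?_ ((L2.integrable_norm_sq f).const_mul _) (ae_of_all _ fun ξ => ?_)
    · filter_upwards [hm] with i hi
      exact ((hi.1.sub hm₀.1).pow_const 2).aestronglyMeasurable.mul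
        (L2.integrable_norm_sq f).aestronglyMeasurable
    · filter_upwards [hm] with i hi
      refine ae_of_all _ fun ξ => ?_
      rw [norm_mul, norm_pow, norm_pow, norm_norm]
      have h1 : |m i ξ - m₀ ξ| ≤ 2 * C :=
        (abs_sub _ _).trans (by linarith [hi.2 ξ, hm₀.2 ξ])
      exact mul_le_mul_of_nonneg_right (pow_le_pow_left₀ (norm_nonneg _) h1 2) (sq_nonneg _)
    · refine Tendsto.mul_const _ ?_
      have := ((hlim ξ).sub_const (m₀ ξ)).pow 2
      simpa using this
  have heq : ∀ᶠ i in l,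
      √(∫ ξ, (m i ξ - m₀ ξ) ^ 2 * ‖f ξ‖ ^ 2) = ‖mulOp (m i) f - mulOp m₀ f‖ := by
    filter_upwards [hm] with i hi
    rw [Real.sqrt_eq_iff_eq_sq (integral_nonneg fun ξ => by positivity) (norm_nonneg _),
      L2.norm_sq_eq_integral]
    refine integral_congr_ae ?_
    filter_upwards [hi.coeFn_mulOp f, hm₀.coeFn_mulOp f,
      Lp.coeFn_sub (mulOp (m i) f) (mulOp m₀ f)] with ξ h1 h2 h3
    rw [h3, Pi.sub_apply, h1, h2, ← sub_mul, norm_mul, mul_pow, ← Complex.ofReal_sub,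
      Complex.norm_real, Real.norm_eq_abs, sq_abs]
  have := hsq.sqrt
  rw [Real.sqrt_zero] at this
  exact this.congr' heq

lemma continuousOn_mulOp {m : ℝ → EuclideanSpace ℝ (Fin n) → ℝ} {C : ℝ → ℝ}
    (hC : ContinuousOn C (Ici 0)) (hm : ∀ t ≥ 0, IsSymbol (C t) (m t))
    (hcont : ∀ ξ, ContinuousOn (fun t => m t ξ) (Ici 0)) (f : L2 n) :
    ContinuousOn (fun t => mulOp (m t) f) (Ici 0) := by
  intro t ht
  have hev : ∀ᶠ s in 𝓝[Ici 0] t, C s < C t + 1 :=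
    (hC t ht).eventually (gt_mem_nhds (lt_add_one _))
  refine tendsto_mulOp (C := C t + 1) ?_
    ⟨(hm t ht).1, fun ξ => ((hm t ht).2 ξ).trans (by linarith)⟩ (fun ξ => hcont ξ t ht) f
  filter_upwards [hev, self_mem_nhdsWithin] with s hs hs0
  exact ⟨(hm s hs0).1, fun ξ => ((hm s hs0).2 ξ).trans hs.le⟩

lemma hasDerivWithinAt_mulOp {m m' : ℝ → EuclideanSpace ℝ (Fin n) → ℝ} {C C' : ℝ → ℝ}
    (hC' : ContinuousOn C' (Ici 0)) (hm : ∀ t ≥ 0, IsSymbol (C t) (m t))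
    (hm' : ∀ t ≥ 0, IsSymbol (C' t) (m' t))
    (hd : ∀ ξ, ∀ t ≥ 0, HasDerivWithinAt (fun t => m t ξ) (m' t ξ) (Ici 0) t) (f : L2 n)
    {t : ℝ} (ht : 0 ≤ t) :
    HasDerivWithinAt (fun t => mulOp (m t) f) (mulOp (m' t) f) (Ici 0) t := by
  obtain ⟨K, hK⟩ := (isCompact_Icc (a := 0) (b := t + 1)).exists_bound_of_continuousOn
    (hC'.mono Icc_subset_Ici_self)
  have hK' : ∀ s ∈ Icc 0 (t + 1), ∀ ξ, |m' s ξ| ≤ K := fun s hs ξ =>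
    ((hm' s hs.1).2 ξ).trans ((le_abs_self _).trans (hK s hs))
  rw [hasDerivWithinAt_iff_tendsto_slope]
  have hmem : ∀ᶠ s in 𝓝[Ici 0 \ {t}] t, s ∈ Icc 0 (t + 1) ∧ s ≠ t := by
    have h1 : ∀ᶠ s in 𝓝[Ici 0 \ {t}] t, s < t + 1 :=
      mem_nhdsWithin_of_mem_nhds (gt_mem_nhds (lt_add_one t))
    filter_upwards [h1, self_mem_nhdsWithin] with s hs hs'
    exact ⟨⟨hs'.1, hs.le⟩, hs'.2⟩
  have htI : t ∈ Icc 0 (t + 1) := ⟨ht, by linarith⟩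
  -- the difference quotients are multiplication operators, bounded by the mean value theorem
  have hslope : ∀ s ∈ Icc 0 (t + 1), s ≠ t → IsSymbol K (fun ξ => slope (fun t => m t ξ) t s) := by
    intro s hs hst
    refine ⟨?_, fun ξ => ?_⟩
    · simp only [slope_def_field]
      exact ((hm s hs.1).1.sub (hm t ht).1).div_const _
    · have := (convex_Icc 0 (t + 1)).norm_image_sub_le_of_norm_hasDerivWithin_le
        (f := fun t => m t ξ) (fun x hx => (hd ξ x hx.1).mono Icc_subset_Ici_self)
        (fun x hx => hK' x hx ξ) htI hs
      simp only [slope_def_field, abs_div]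
      exact div_le_of_le_mul₀ (abs_nonneg _) ((abs_nonneg _).trans (hK' t htI ξ)) this
  have key := tendsto_mulOp (C := K) (l := 𝓝[Ici 0 \ {t}] t)
    (m := fun s ξ => slope (fun t => m t ξ) t s) (m₀ := m' t)
    (hmem.mono fun s hs => hslope s hs.1 hs.2) ⟨(hm' t ht).1, hK' t htI⟩
    (fun ξ => hasDerivWithinAt_iff_tendsto_slope.1 (hd ξ t ht)) f
  refine key.congr' ?_
  filter_upwards [hmem] with s hs
  rw [slope_def_module]
  refine Lp.ext ?_
  filter_upwards [(hslope s hs.1 hs.2).coeFn_mulOp f, (hm s hs.1.1).coeFn_mulOp f,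
    (hm t ht).coeFn_mulOp f, Lp.coeFn_sub (mulOp (m s) f) (mulOp (m t) f),
    Lp.coeFn_smul (s - t)⁻¹ (mulOp (m s) f - mulOp (m t) f)] with ξ h1 h2 h3 h4 h5
  rw [h1, h5, Pi.smul_apply, h4, Pi.sub_apply, h2, h3, slope_def_field, Complex.real_smul]
  push_cast
  ring

/-! ### Pairing with test functions on the Fourier side -/

/-- The functional `h ↦ ∫ k h` on `L²`. -/
lemma exists_integral_functional {k : EuclideanSpace ℝ (Fin n) → ℂ} (hk : MemLp k 2) :
    ∃ ℓ : L2 n →L[ℂ] ℂ, ∀ h : L2 n, ℓ h = ∫ ξ, k ξ * h ξ := by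
  have hk' : MemLp (fun ξ => (starRingEnd ℂ) (k ξ)) 2 := hk.star
  refine ⟨innerSL ℂ (hk'.toLp _), fun h => ?_⟩
  rw [innerSL_apply_apply, L2.inner_def]
  refine integral_congr_ae ?_
  filter_upwards [hk'.coeFn_toLp] with ξ hξ
  rw [hξ, RCLike.inner_apply, RCLike.conj_conj, mul_comm]

/-- Since the Fourier transform is transposed to itself, the test function is transformed by its
inverse. -/
lemma pairing_eq_fourier (f : L2 n) (φ : 𝓢(EuclideanSpace ℝ (Fin n), ℂ)) :
    (f : 𝓢'(EuclideanSpace ℝ (Fin n), ℂ)) φ = ∫ ξ, (𝓕⁻ φ) ξ * (𝓕 f : L2 n) ξ := by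
  have h := congrArg (fun T : 𝓢'(EuclideanSpace ℝ (Fin n), ℂ) => T (𝓕⁻ φ))
    (Lp.fourier_toTemperedDistribution_eq f)
  simp only [TemperedDistribution.fourier_apply, FourierTransform.fourier_fourierInv_eq,
    Lp.toTemperedDistribution_apply, smul_eq_mul] at h
  rw [← h, Lp.toTemperedDistribution_apply]
  rfl

lemma laplacian_pairing_eq_fourier (f : L2 n) (φ : 𝓢(EuclideanSpace ℝ (Fin n), ℂ)) :
    (Δ (f : 𝓢'(EuclideanSpace ℝ (Fin n), ℂ))) φ =
      ∫ ξ, -(((2 * Real.pi * ‖ξ‖) ^ 2 : ℝ) : ℂ) * (𝓕⁻ φ) ξ * (𝓕 f : L2 n) ξ := by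
  have hg : (fun ξ : EuclideanSpace ℝ (Fin n) => Complex.ofReal (‖ξ‖ ^ 2)).HasTemperateGrowth := by
    fun_prop
  set ψ : 𝓢(EuclideanSpace ℝ (Fin n), ℂ) := SchwartzMap.smulLeftCLM ℂ
    (fun ξ : EuclideanSpace ℝ (Fin n) => Complex.ofReal (‖ξ‖ ^ 2)) (𝓕⁻ φ) with hψ
  have h1 : (Δ (f : 𝓢'(EuclideanSpace ℝ (Fin n), ℂ))) φ =
      (-(2 * Real.pi) ^ 2 : ℝ) • (f : 𝓢'(EuclideanSpace ℝ (Fin n), ℂ)) (𝓕 ψ) := by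
    rw [TemperedDistribution.laplacian_eq_fourierMultiplierCLM]
    rfl
  rw [h1, pairing_eq_fourier, FourierTransform.fourierInv_fourier_eq, ← integral_smul]
  refine integral_congr_ae (ae_of_all _ fun ξ => ?_)
  simp only [hψ, SchwartzMap.smulLeftCLM_apply_apply hg, Complex.real_smul, smul_eq_mul]
  push_cast
  ring

/-! ### Linearity of the notions in the energy class -/

lemma IsMultiplierImage.smul_add {m : ℝ → ℝ} {f₁ g₁ f₂ g₂ : L2 n} (c : ℂ)
    (h₁ : IsMultiplierImage m f₁ g₁) (h₂ : IsMultiplierImage m f₂ g₂) :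
    IsMultiplierImage m (c • f₁ + f₂) (c • g₁ + g₂) := by
  unfold IsMultiplierImage at *
  rw [FourierTransform.fourier_add, FourierTransform.fourier_smul, FourierTransform.fourier_add,
    FourierTransform.fourier_smul]
  filter_upwards [h₁, h₂, Lp.coeFn_add (c • 𝓕 f₁ : L2 n) (𝓕 f₂), Lp.coeFn_smul c (𝓕 f₁ : L2 n),
    Lp.coeFn_add (c • 𝓕 g₁ : L2 n) (𝓕 g₂), Lp.coeFn_smul c (𝓕 g₁ : L2 n)] with ξ e1 e2 e3 e4 e5 e6
  rw [e3, e5, Pi.add_apply, Pi.add_apply, e4, e6, Pi.smul_apply, Pi.smul_apply, e1, e2,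
    smul_eq_mul, smul_eq_mul]
  ring

lemma toTemperedDistribution_smul_add_apply (c : ℂ) (f g : L2 n)
    (φ : 𝓢(EuclideanSpace ℝ (Fin n), ℂ)) :
    ((c • f + g : L2 n) : 𝓢'(EuclideanSpace ℝ (Fin n), ℂ)) φ =
      c * (f : 𝓢'(EuclideanSpace ℝ (Fin n), ℂ)) φ +
        (g : 𝓢'(EuclideanSpace ℝ (Fin n), ℂ)) φ := by
  have h := (Lp.toTemperedDistributionCLM (E := EuclideanSpace ℝ (Fin n)) ℂ volume 2).map_add
    (c • f) g
  rw [map_smul] at h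
  have h2 := congrArg (fun T : 𝓢'(EuclideanSpace ℝ (Fin n), ℂ) => T φ) h
  exact h2

lemma IsEnergySolution.smul_add {b : ℝ → ℝ} {u₁ u₁' u₂ u₂' : ℝ → L2 n} (c : ℂ)
    (h₁ : IsEnergySolution b u₁ u₁') (h₂ : IsEnergySolution b u₂ u₂') :
    IsEnergySolution b (fun t => c • u₁ t + u₂ t) (fun t => c • u₁' t + u₂' t) where
  continuous_sobolev := by
    obtain ⟨w₁, hc₁, hw₁⟩ := h₁.continuous_sobolev
    obtain ⟨w₂, hc₂, hw₂⟩ := h₂.continuous_sobolev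
    exact ⟨fun t => c • w₁ t + w₂ t, (hc₁.const_smul c).add hc₂,
      fun t ht => (hw₁ t ht).smul_add c (hw₂ t ht)⟩
  hasDeriv t ht := ((h₁.hasDeriv t ht).const_smul c).add (h₂.hasDeriv t ht)
  continuous_deriv := (h₁.continuous_deriv.const_smul c).add h₂.continuous_deriv
  equation φ t ht := by
    have h := ((h₁.equation φ t ht).const_mul c).add (h₂.equation φ t ht)
    simp only [TemperedDistribution.laplacian_apply_apply] at h ⊢
    simp only [toTemperedDistribution_smul_add_apply]
    convert! h using 1
    ring

/-- Being a solution only involves the coefficient on `[0, ∞)`. -/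
lemma IsEnergySolution.congr {b β : ℝ → ℝ} (hbβ : EqOn b β (Ici 0)) {u ut : ℝ → L2 n}
    (h : IsEnergySolution b u ut) : IsEnergySolution β u ut where
  continuous_sobolev := h.continuous_sobolev
  hasDeriv := h.hasDeriv
  continuous_deriv := h.continuous_deriv
  equation φ t ht := by
    rw [← hbβ ht]
    exact h.equation φ t ht

lemma isMultiplierImage_fourierInv {C : ℝ} {m : ℝ → ℝ} {p q : EuclideanSpace ℝ (Fin n) → ℝ}
    {C' : ℝ} (hp : IsSymbol C p) (hq : IsSymbol C' q)
    (h : ∀ ξ, q ξ = m (2 * Real.pi * ‖ξ‖) * p ξ) (f : L2 n) :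
    IsMultiplierImage m (𝓕⁻ (mulOp p f) : L2 n) (𝓕⁻ (mulOp q f) : L2 n) := by
  unfold IsMultiplierImage
  rw [FourierTransform.fourier_fourierInv_eq, FourierTransform.fourier_fourierInv_eq]
  filter_upwards [hp.coeFn_mulOp f, hq.coeFn_mulOp f] with ξ h1 h2
  rw [h1, h2, h]
  push_cast
  ring

/-! ### Existence of solutions -/

/-- `m(t, ξ)` solves the wave equation on the Fourier side for each `ξ`, with data whose energy
(including the zeroth-order term) is at most `1`; `m'` is its time derivative. -/
structure IsSymbolFlow (b : ℝ → ℝ) (m m' : ℝ → EuclideanSpace ℝ (Fin n) → ℝ) : Prop where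
  measurable : ∀ t, Measurable (m t)
  measurable' : ∀ t, Measurable (m' t)
  isMode : ∀ ξ, IsMode b (2 * Real.pi * ‖ξ‖) (fun t => m t ξ) (fun t => m' t ξ)
  data_le : ∀ ξ, (1 + (2 * Real.pi * ‖ξ‖) ^ 2) * m 0 ξ ^ 2 + m' 0 ξ ^ 2 ≤ 1

namespace IsSymbolFlow

variable {b : ℝ → ℝ} {m m' : ℝ → EuclideanSpace ℝ (Fin n) → ℝ}

lemma energy_le_one (h : IsSymbolFlow b m m') (h0 : ∀ t, 0 ≤ b t) {t : ℝ} (ht : 0 ≤ t)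
    (ξ : EuclideanSpace ℝ (Fin n)) :
    (2 * Real.pi * ‖ξ‖) ^ 2 * m t ξ ^ 2 + m' t ξ ^ 2 ≤ 1 := by
  refine ((h.isMode ξ).energy_le h0 ht).trans (le_trans ?_ (h.data_le ξ))
  nlinarith [sq_nonneg (m 0 ξ)]

lemma isSymbol_deriv (h : IsSymbolFlow b m m') (h0 : ∀ t, 0 ≤ b t) {t : ℝ} (ht : 0 ≤ t) :
    IsSymbol 1 (m' t) :=
  ⟨h.measurable' t, fun ξ => abs_le_one_iff_mul_self_le_one.2 (by
    have := h.energy_le_one h0 ht ξ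
    nlinarith [sq_nonneg (2 * Real.pi * ‖ξ‖ * m t ξ)])⟩

lemma isSymbol_freq_mul (h : IsSymbolFlow b m m') (h0 : ∀ t, 0 ≤ b t) {t : ℝ} (ht : 0 ≤ t) :
    IsSymbol 1 (fun ξ => 2 * Real.pi * ‖ξ‖ * m t ξ) :=
  ⟨(measurable_norm.const_mul _).mul (h.measurable t),
    fun ξ => abs_le_one_iff_mul_self_le_one.2 (by
      have := h.energy_le_one h0 ht ξ
      nlinarith [sq_nonneg (m' t ξ)])⟩

lemma isSymbol (h : IsSymbolFlow b m m') (h0 : ∀ t, 0 ≤ b t) {t : ℝ} (ht : 0 ≤ t) :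
    IsSymbol (1 + t) (m t) := by
  refine ⟨h.measurable t, fun ξ => ?_⟩
  have h1 := (convex_Icc 0 t).norm_image_sub_le_of_norm_hasDerivWithin_le (C := 1)
    (fun x hx => ((h.isMode ξ).hasDeriv x hx.1).mono Icc_subset_Ici_self)
    (fun x hx => (h.isSymbol_deriv h0 hx.1).2 ξ) (left_mem_Icc.2 ht) (right_mem_Icc.2 ht)
  have h2 : |m 0 ξ| ≤ 1 := abs_le_one_iff_mul_self_le_one.2 (by
    have := h.data_le ξ
    nlinarith [sq_nonneg (2 * Real.pi * ‖ξ‖ * m 0 ξ), sq_nonneg (m' 0 ξ)])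
  rw [Real.norm_eq_abs, Real.norm_eq_abs, sub_zero, abs_of_nonneg ht, one_mul] at h1
  have h3 := abs_sub_abs_le_abs_sub (m t ξ) (m 0 ξ)
  linarith

lemma isSymbol_bracket_mul (h : IsSymbolFlow b m m') (h0 : ∀ t, 0 ≤ b t) {t : ℝ} (ht : 0 ≤ t) :
    IsSymbol (2 + t) (fun ξ => √(1 + (2 * Real.pi * ‖ξ‖) ^ 2) * m t ξ) := by
  refine ⟨Measurable.mul (by fun_prop) (h.measurable t), fun ξ => ?_⟩
  have h1 := (h.isSymbol h0 ht).2 ξ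
  have h2 := (h.isSymbol_freq_mul h0 ht).2 ξ
  have hr : 0 ≤ 2 * Real.pi * ‖ξ‖ := by positivity
  have h3 : √(1 + (2 * Real.pi * ‖ξ‖) ^ 2) ≤ 1 + 2 * Real.pi * ‖ξ‖ :=
    Real.sqrt_le_iff.2 ⟨by positivity, by nlinarith⟩
  rw [abs_mul, abs_of_nonneg hr] at h2
  rw [abs_mul, abs_of_nonneg (Real.sqrt_nonneg _)]
  nlinarith [mul_le_mul_of_nonneg_right h3 (abs_nonneg (m t ξ))]

lemma isSymbol_weighted_deriv (h : IsSymbolFlow b m m') (h0 : ∀ t, 0 ≤ b t) {t : ℝ}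
    (ht : 0 ≤ t) : IsSymbol 1 (fun ξ => (1 + (2 * Real.pi * ‖ξ‖) ^ 2)⁻¹ * m' t ξ) := by
  refine ⟨Measurable.mul (by fun_prop) (h.measurable' t), fun ξ => ?_⟩
  have h1 := (h.isSymbol_deriv h0 ht).2 ξ
  rw [abs_mul, abs_of_nonneg (by positivity)]
  have : (1 + (2 * Real.pi * ‖ξ‖) ^ 2)⁻¹ ≤ 1 :=
    inv_le_one_of_one_le₀ (by nlinarith [sq_nonneg (2 * Real.pi * ‖ξ‖)])
  exact mul_le_one₀ this (abs_nonneg _) h1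

lemma isSymbol_weighted_second_deriv (h : IsSymbolFlow b m m') (h0 : ∀ t, 0 ≤ b t) {t : ℝ}
    (ht : 0 ≤ t) : IsSymbol (b t + (1 + t)) (fun ξ => (1 + (2 * Real.pi * ‖ξ‖) ^ 2)⁻¹ *
      (-(b t * m' t ξ) - (2 * Real.pi * ‖ξ‖) ^ 2 * m t ξ)) := by
  have hm := h.measurable t
  have hm' := h.measurable' t
  refine ⟨by fun_prop, fun ξ => ?_⟩
  have h1 := (h.isSymbol_deriv h0 ht).2 ξ
  have h2 := (h.isSymbol h0 ht).2 ξ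
  set s := (2 * Real.pi * ‖ξ‖) ^ 2
  have hs : 0 ≤ s := sq_nonneg _
  rw [abs_mul, abs_of_nonneg (by positivity), inv_mul_le_iff₀ (by positivity)]
  have h3 : |-(b t * m' t ξ) - s * m t ξ| ≤ b t * |m' t ξ| + s * |m t ξ| := by
    refine (abs_sub _ _).trans ?_
    rw [abs_neg, abs_mul, abs_mul, abs_of_nonneg (h0 t), abs_of_nonneg hs]
  have h4 := mul_le_mul_of_nonneg_left h1 (h0 t)
  have h5 := mul_le_mul_of_nonneg_left h2 hs
  nlinarith [h0 t, mul_nonneg hs (h0 t)]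

/-- The equation is tested on the Fourier side. There the weight `(1 + |2πξ|²)⁻¹` makes the second
time derivative a bounded symbol; it is compensated by the decay of the test function. -/
theorem isEnergySolution (h : IsSymbolFlow b m m') (hb : Continuous b) (h0 : ∀ t, 0 ≤ b t)
    (g : L2 n) :
    IsEnergySolution b (fun t => (𝓕⁻ (mulOp (m t) g) : L2 n))
      (fun t => (𝓕⁻ (mulOp (m' t) g) : L2 n)) where
  continuous_sobolev := by
    refine ⟨fun t => 𝓕⁻ (mulOp (fun ξ => √(1 + (2 * Real.pi * ‖ξ‖) ^ 2) * m t ξ) g), ?_,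
      fun t ht => isMultiplierImage_fourierInv (h.isSymbol h0 ht) (h.isSymbol_bracket_mul h0 ht)
        (fun ξ => rfl) g⟩
    refine (fourierInvCLM ℂ (L2 n)).continuous.comp_continuousOn
      (continuousOn_mulOp (C := fun t => 2 + t) (by fun_prop)
        (fun t ht => h.isSymbol_bracket_mul h0 ht)
        (fun ξ t ht => ((h.isMode ξ).hasDeriv t ht).continuousWithinAt.const_mul _) g)
  hasDeriv t ht :=
    ((fourierInvCLM ℂ (L2 n)).restrictScalars ℝ).hasFDerivAt.comp_hasDerivWithinAt t
      (hasDerivWithinAt_mulOp (C := fun t => 1 + t) (C' := fun _ => 1) (by fun_prop)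
        (fun t ht => h.isSymbol h0 ht) (fun t ht => h.isSymbol_deriv h0 ht)
        (fun ξ t ht => (h.isMode ξ).hasDeriv t ht) g ht)
  continuous_deriv :=
    (fourierInvCLM ℂ (L2 n)).continuous.comp_continuousOn
      (continuousOn_mulOp (C := fun _ => 1) (by fun_prop)
        (fun t ht => h.isSymbol_deriv h0 ht)
        (fun ξ t ht => ((h.isMode ξ).hasDeriv' t ht).continuousWithinAt) g)
  equation φ t ht := by
    have hg : (fun ξ : EuclideanSpace ℝ (Fin n) =>
        (1 : ℂ) + Complex.ofReal ((2 * Real.pi) ^ 2) *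
          Complex.ofReal (‖ξ‖ ^ 2)).HasTemperateGrowth := by
      fun_prop
    set k : 𝓢(EuclideanSpace ℝ (Fin n), ℂ) := SchwartzMap.smulLeftCLM ℂ
      (fun ξ : EuclideanSpace ℝ (Fin n) =>
        (1 : ℂ) + Complex.ofReal ((2 * Real.pi) ^ 2) * Complex.ofReal (‖ξ‖ ^ 2)) (𝓕⁻ φ)
    have hk : ∀ ξ, k ξ = ((1 + (2 * Real.pi * ‖ξ‖) ^ 2 : ℝ) : ℂ) * (𝓕⁻ φ) ξ := fun ξ => by
      simp only [k, SchwartzMap.smulLeftCLM_apply_apply hg, smul_eq_mul]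
      push_cast
      ring
    obtain ⟨ℓ, hℓ⟩ := exists_integral_functional (k.memLp 2)
    have hder := (ℓ.restrictScalars ℝ).hasFDerivAt.comp_hasDerivWithinAt t
      (hasDerivWithinAt_mulOp (C := fun _ => 1) (C' := fun t => b t + (1 + t))
        (m := fun t ξ => (1 + (2 * Real.pi * ‖ξ‖) ^ 2)⁻¹ * m' t ξ)
        (m' := fun t ξ => (1 + (2 * Real.pi * ‖ξ‖) ^ 2)⁻¹ *
          (-(b t * m' t ξ) - (2 * Real.pi * ‖ξ‖) ^ 2 * m t ξ)) (by fun_prop)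
        (fun t ht => h.isSymbol_weighted_deriv h0 ht)
        (fun t ht => h.isSymbol_weighted_second_deriv h0 ht)
        (fun ξ t ht => ((h.isMode ξ).hasDeriv' t ht).const_mul _) g ht)
    have hpos : ∀ ξ : EuclideanSpace ℝ (Fin n),
        ((1 + (2 * Real.pi * ‖ξ‖) ^ 2 : ℝ) : ℂ) ≠ 0 := fun ξ => by
      exact_mod_cast (by positivity : (1 + (2 * Real.pi * ‖ξ‖) ^ 2 : ℝ) ≠ 0)
    have hpair : ∀ s ≥ 0, ℓ (mulOp (fun ξ => (1 + (2 * Real.pi * ‖ξ‖) ^ 2)⁻¹ * m' s ξ) g) =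
        ((𝓕⁻ (mulOp (m' s) g) : L2 n) : 𝓢'(EuclideanSpace ℝ (Fin n), ℂ)) φ := by
      intro s hs
      rw [hℓ, pairing_eq_fourier, FourierTransform.fourier_fourierInv_eq]
      refine integral_congr_ae ?_
      filter_upwards [(h.isSymbol_weighted_deriv h0 hs).coeFn_mulOp g,
        (h.isSymbol_deriv h0 hs).coeFn_mulOp g] with ξ h1 h2
      rw [h1, h2, hk]
      have := hpos ξ
      push_cast [mul_pow] at this ⊢
      field_simp
    refine (hder.congr_of_eventuallyEq ?_ (hpair t ht).symm).congr_deriv ?_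
    · filter_upwards [self_mem_nhdsWithin] with s hs
      exact (hpair s hs).symm
    · change ℓ _ = _
      rw [hℓ, laplacian_pairing_eq_fourier, pairing_eq_fourier,
        FourierTransform.fourier_fourierInv_eq, FourierTransform.fourier_fourierInv_eq,
        ← integral_const_mul, ← integral_sub]
      · refine integral_congr_ae ?_
        filter_upwards [(h.isSymbol_weighted_second_deriv h0 ht).coeFn_mulOp g,
          (h.isSymbol_deriv h0 ht).coeFn_mulOp g, (h.isSymbol h0 ht).coeFn_mulOp g] with ξ h1 h2 h3
        rw [h1, h2, h3, hk]
        have := hpos ξ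
        push_cast [mul_pow] at this ⊢
        field_simp
        ring
      · have h1 : Integrable (fun ξ => -(k ξ - (𝓕⁻ φ) ξ) * (mulOp (m t) g) ξ) :=
          ((k.memLp 2).sub ((𝓕⁻ φ).memLp 2)).neg.integrable_mul (Lp.memLp (mulOp (m t) g))
        refine h1.congr (ae_of_all _ fun ξ => ?_)
        simp only [hk]
        push_cast
        ring
      · exact (((𝓕⁻ φ).memLp 2).integrable_mul (Lp.memLp (mulOp (m' t) g))).const_mul _

end IsSymbolFlow

/-! ### Uniqueness of solutions -/

lemma mulOp_mulOp {p q s : EuclideanSpace ℝ (Fin n) → ℝ} {C₁ C₂ C₃ : ℝ} (hp : IsSymbol C₁ p)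
    (hq : IsSymbol C₂ q) (hs : IsSymbol C₃ s) (h : ∀ ξ, s ξ = p ξ * q ξ) (f : L2 n) :
    mulOp p (mulOp q f) = mulOp s f := by
  refine Lp.ext ?_
  filter_upwards [hp.coeFn_mulOp (mulOp q f), hq.coeFn_mulOp f, hs.coeFn_mulOp f] with ξ h1 h2 h3
  rw [h1, h2, h3, h]
  push_cast
  ring

/-- The cutoff `p(ξ) 1_{|ξ| < R}`. -/
noncomputable def cutoff (R : ℝ) (p : EuclideanSpace ℝ (Fin n) → ℝ) :
    EuclideanSpace ℝ (Fin n) → ℝ :=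
  (Metric.ball 0 R).indicator p

lemma isSymbol_cutoff_one (R : ℝ) :
    IsSymbol 1 (cutoff R (fun _ : EuclideanSpace ℝ (Fin n) => 1)) :=
  ⟨measurable_const.indicator measurableSet_ball, fun ξ => by
    by_cases h : ξ ∈ Metric.ball (0 : EuclideanSpace ℝ (Fin n)) R <;> simp [cutoff, h]⟩

lemma isSymbol_cutoff_sq (R : ℝ) :
    IsSymbol ((2 * Real.pi * R) ^ 2)
      (cutoff R (fun ξ : EuclideanSpace ℝ (Fin n) => (2 * Real.pi * ‖ξ‖) ^ 2)) := by
  refine ⟨Measurable.indicator (by fun_prop) measurableSet_ball, fun ξ => ?_⟩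
  by_cases h : ξ ∈ Metric.ball (0 : EuclideanSpace ℝ (Fin n)) R
  · rw [cutoff, indicator_of_mem h, abs_of_nonneg (sq_nonneg _)]
    have : ‖ξ‖ ≤ R := (mem_ball_zero_iff.1 h).le
    gcongr
  · rw [cutoff, indicator_of_notMem h, abs_zero]
    positivity

/-- A solution with data zero vanishes. After the frequencies are cut off to a ball, the equation
is a linear ordinary differential equation in `L²` with bounded coefficients. It holds weakly at
first, and in norm because its right hand side is continuous in time. -/
theorem IsEnergySolution.eq_zero {b : ℝ → ℝ} (hb : Continuous b) {u ut : ℝ → L2 n}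
    (h : IsEnergySolution b u ut) (hu : u 0 = 0) (hut : ut 0 = 0) {t : ℝ} (ht : 0 ≤ t) :
    u t = 0 ∧ ut t = 0 := by
  set F := fourierCLM ℂ (L2 n) (F := L2 n) with hF
  have hmax : Continuous fun t : ℝ => max t 0 := by fun_prop
  have huc : Continuous fun t => u (max t 0) :=
    ContinuousOn.comp_continuous (s := Ici 0) (fun t ht => (h.hasDeriv t ht).continuousWithinAt)
      hmax fun t => le_max_right t 0
  have hutc : Continuous fun t => ut (max t 0) :=
    ContinuousOn.comp_continuous h.continuous_deriv hmax fun t => le_max_right t 0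
  have key : ∀ R : ℝ, ∀ t ≥ 0,
      mulOp (cutoff R fun _ => 1) (F (u t)) = 0 ∧ mulOp (cutoff R fun _ => 1) (F (ut t)) = 0 := by
    intro R
    set χ := mulOp (n := n) (cutoff R fun _ => 1)
    set κ := mulOp (n := n) (cutoff R fun ξ => (2 * Real.pi * ‖ξ‖) ^ 2)
    have hχχ : ∀ f, χ (χ f) = χ f := fun f =>
      mulOp_mulOp (isSymbol_cutoff_one R) (isSymbol_cutoff_one R) (isSymbol_cutoff_one R)
        (fun ξ => by
          by_cases h : ξ ∈ Metric.ball (0 : EuclideanSpace ℝ (Fin n)) R <;> simp [cutoff, h]) f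
    have hχκ : ∀ f, χ (κ f) = κ f := fun f =>
      mulOp_mulOp (isSymbol_cutoff_one R) (isSymbol_cutoff_sq R) (isSymbol_cutoff_sq R)
        (fun ξ => by
          by_cases h : ξ ∈ Metric.ball (0 : EuclideanSpace ℝ (Fin n)) R <;> simp [cutoff, h]) f
    set U : ℝ → L2 n := fun t => χ (F (u (max t 0)))
    set V : ℝ → L2 n := fun t => χ (F (ut (max t 0)))
    set G : ℝ → L2 n := fun t => -κ (U t) - (b t : ℂ) • V t
    have hUc : Continuous U := χ.continuous.comp (F.continuous.comp huc)
    have hVc : Continuous V := χ.continuous.comp (F.continuous.comp hutc)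
    have hGc : Continuous G := ((κ.continuous.comp hUc).neg).sub
      ((Complex.continuous_ofReal.comp hb).smul hVc)
    have hI : ∀ t, HasDerivAt (fun t => ∫ s in (0 : ℝ)..t, G s) (G t) t := fun t =>
      intervalIntegral.integral_hasDerivAt_right (hGc.intervalIntegrable 0 t)
        hGc.aestronglyMeasurable.stronglyMeasurableAtFilter hGc.continuousAt
    -- the weak equation, integrated in time, is an identity in `L²`
    have hV : ∀ t ≥ 0, V t = ∫ s in (0 : ℝ)..t, G s := by
      intro t ht
      set D := V t - ∫ s in (0 : ℝ)..t, G s with hD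
      have hχD : χ D = D := by
        rw [hD, map_sub, ← χ.intervalIntegral_comp_comm (hGc.intervalIntegrable 0 t)]
        congr 1
        · exact hχχ _
        · refine intervalIntegral.integral_congr fun s _ => ?_
          simp only [G, map_sub, map_neg, map_smul, hχκ]
          rw [hχχ]
      -- against test functions supported in the ball the cutoff is invisible
      have hball : ∀ᵐ ξ, ξ ∈ Metric.ball (0 : EuclideanSpace ℝ (Fin n)) R → D ξ = 0 := by
        refine Metric.isOpen_ball.ae_eq_zero_of_integral_contDiff_smul_eq_zero
          (((Lp.memLp D).locallyIntegrable one_le_two).locallyIntegrableOn _) ?_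
        intro g g_smooth g_cpt g_supp
        have hg₁ : HasCompactSupport (Complex.ofRealCLM ∘ g) := g_cpt.comp_left rfl
        have hg₂ : ContDiff ℝ ∞ (Complex.ofRealCLM ∘ g) := by fun_prop
        set k := hg₁.toSchwartzMap hg₂
        have hk : ∀ ξ, k ξ = (g ξ : ℂ) := fun ξ => rfl
        have hk0 : ∀ ξ, ξ ∉ Metric.ball (0 : EuclideanSpace ℝ (Fin n)) R → k ξ = 0 :=
          fun ξ hξ => by
            rw [hk, image_eq_zero_of_notMem_tsupport fun h => hξ (g_supp h), Complex.ofReal_zero]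
        obtain ⟨ℓ, hℓ⟩ := exists_integral_functional (k.memLp 2)
        have hℓχ : ∀ f, ℓ (χ f) = ∫ ξ, k ξ * f ξ := fun f => by
          rw [hℓ]
          refine integral_congr_ae ?_
          filter_upwards [(isSymbol_cutoff_one R).coeFn_mulOp f] with ξ h1
          rw [h1]
          by_cases h : ξ ∈ Metric.ball (0 : EuclideanSpace ℝ (Fin n)) R
          · simp [cutoff, h]
          · simp [hk0 ξ h]
        have hℓκ : ∀ f, ℓ (κ (χ f)) = -∫ ξ, -(((2 * Real.pi * ‖ξ‖) ^ 2 : ℝ) : ℂ) * k ξ * f ξ :=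
          fun f => by
            rw [hℓ, ← integral_neg]
            refine integral_congr_ae ?_
            filter_upwards [(isSymbol_cutoff_one R).coeFn_mulOp f,
              (isSymbol_cutoff_sq R).coeFn_mulOp (χ f)] with ξ h1 h2
            rw [h2, h1]
            by_cases h : ξ ∈ Metric.ball (0 : EuclideanSpace ℝ (Fin n)) R
            · simp only [cutoff, indicator_of_mem h]
              push_cast
              ring
            · simp [hk0 ξ h]
        have hpair : ∀ s ≥ 0, ℓ (V s) =
            (ut s : 𝓢'(EuclideanSpace ℝ (Fin n), ℂ)) (𝓕 k) := by
          intro s hs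
          rw [pairing_eq_fourier, FourierTransform.fourierInv_fourier_eq]
          simp only [V, max_eq_left hs]
          exact hℓχ _
        have hder : ∀ s ≥ 0, HasDerivWithinAt (fun s => ℓ (V s)) (ℓ (G s)) (Ici 0) s := by
          intro s hs
          refine ((h.equation (𝓕 k) s hs).congr hpair (hpair s hs)).congr_deriv ?_
          rw [← hpair s hs, laplacian_pairing_eq_fourier, FourierTransform.fourierInv_fourier_eq]
          simp only [G, map_sub, map_neg, map_smul, smul_eq_mul]
          congr 1
          simp only [U, max_eq_left hs]
          rw [hℓκ, neg_neg]
          rfl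
        have hℓI : ∀ s, HasDerivAt (fun s => ℓ (∫ x in (0 : ℝ)..s, G x)) (ℓ (G s)) s := fun s =>
          (ℓ.restrictScalars ℝ).hasFDerivAt.comp_hasDerivAt s (hI s)
        have hdiff : ∀ s ≥ 0, HasDerivWithinAt (fun s => ℓ (V s) - ℓ (∫ x in (0 : ℝ)..s, G x)) 0
            (Ici 0) s := fun s hs => by
          have := (hder s hs).sub (hℓI s).hasDerivWithinAt
          rwa [sub_self] at this
        have hzero := eq_zero_of_abs_deriv_le_mul_abs_self_of_eq_zero_right (K := 0) (a := 0)
          (b := t) (f := fun s => ℓ (V s) - ℓ (∫ x in (0 : ℝ)..s, G x)) (f' := fun _ => 0)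
          (fun s hs => (hdiff s hs.1).continuousWithinAt.mono Icc_subset_Ici_self)
          (fun s hs => (hdiff s hs.1).mono (Ici_subset_Ici.2 hs.1)) (by simp [V, hut])
          (fun s _ => by simp) t (right_mem_Icc.2 ht)
        simp only [← map_sub] at hzero
        rw [hℓ] at hzero
        rw [← hzero]
        refine integral_congr_ae (ae_of_all _ fun ξ => ?_)
        simp only [hk, Complex.real_smul, hD]
      have hD0 : D = 0 := by
        rw [← hχD]
        refine Lp.ext ?_
        filter_upwards [hball, (isSymbol_cutoff_one R).coeFn_mulOp D,
          Lp.coeFn_zero ℂ 2 (volume : Measure (EuclideanSpace ℝ (Fin n)))] with ξ h1 h2 h3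
        rw [h2, h3]
        by_cases h : ξ ∈ Metric.ball (0 : EuclideanSpace ℝ (Fin n)) R
        · simp [h1 h]
        · simp [cutoff, h]
      exact sub_eq_zero.1 hD0
    intro t ht
    have hUd : ∀ s ≥ 0, HasDerivWithinAt U (V s) (Ici s) s := by
      intro s hs
      have h1 := (((χ ∘L F).restrictScalars ℝ).hasFDerivAt.comp_hasDerivWithinAt s
        (h.hasDeriv s hs)).mono (Ici_subset_Ici.2 hs)
      have h2 : ∀ x ∈ Ici s, U x = ((χ ∘L F).restrictScalars ℝ ∘ u) x := fun x hx => by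
        simp only [U, max_eq_left (hs.le.trans hx)]
        rfl
      refine (h1.congr h2 (h2 s self_mem_Ici)).congr_deriv ?_
      simp only [V, max_eq_left (show (0 : ℝ) ≤ s from hs)]
      rfl
    have hVd : ∀ s ≥ 0, HasDerivWithinAt V (G s) (Ici s) s := fun s hs =>
      (hI s).hasDerivWithinAt.congr (fun x hx => hV x (hs.le.trans hx)) (hV s hs)
    obtain ⟨B, hB⟩ := (isCompact_Icc (a := 0) (b := t)).exists_bound_of_continuousOn
      hb.continuousOn
    have hB0 : 0 ≤ B := (norm_nonneg _).trans (hB 0 (left_mem_Icc.2 ht))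
    have hX := eq_zero_of_abs_deriv_le_mul_abs_self_of_eq_zero_right
      (K := 1 + (2 * Real.pi * R) ^ 2 + B) (a := 0) (b := t) (f := fun s => (U s, V s))
      (f' := fun s => (V s, G s)) (hUc.prodMk hVc).continuousOn
      (fun s hs => (hUd s hs.1).prodMk (hVd s hs.1)) (by simp [U, V, hu, hut])
      (fun s hs => by
        have hU1 : ‖U s‖ ≤ ‖(U s, V s)‖ := norm_fst_le (U s, V s)
        have hV1 : ‖V s‖ ≤ ‖(U s, V s)‖ := norm_snd_le (U s, V s)
        have hX0 := norm_nonneg (U s, V s)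
        refine norm_prod_le_iff.2 ⟨?_, ?_⟩
        · refine hV1.trans (le_mul_of_one_le_left hX0 ?_)
          nlinarith [sq_nonneg (2 * Real.pi * R)]
        · have h1 : ‖G s‖ ≤ ‖κ (U s)‖ + ‖b s‖ * ‖V s‖ := by
            refine (norm_sub_le _ _).trans ?_
            rw [norm_neg, norm_smul, Complex.norm_real]
          have h2 := (isSymbol_cutoff_sq R).norm_mulOp_le (U s)
          have h3 := hB s ⟨hs.1, hs.2.le⟩
          calc ‖G s‖ ≤ (2 * Real.pi * R) ^ 2 * ‖(U s, V s)‖ + B * ‖(U s, V s)‖ := by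
                refine h1.trans (add_le_add (h2.trans ?_) ?_) <;> gcongr
            _ ≤ _ := by nlinarith) t (right_mem_Icc.2 ht)
    have h1 : U t = 0 := congrArg Prod.fst hX
    have h2 : V t = 0 := congrArg Prod.snd hX
    simp only [U, V, max_eq_left (show (0 : ℝ) ≤ t from ht)] at h1 h2
    exact ⟨h1, h2⟩
  -- a function that vanishes on all balls is zero
  have hzero : ∀ f : L2 n, (∀ R : ℝ, mulOp (cutoff R fun _ => 1) (F f) = 0) → f = 0 := by
    intro f hf
    have hFf : F f = 0 := by
      refine Lp.ext ?_
      have hall : ∀ᵐ ξ, ∀ N : ℕ,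
          ((cutoff (N : ℝ) (fun _ : EuclideanSpace ℝ (Fin n) => 1) ξ : ℝ) : ℂ) * F f ξ = 0 := by
        refine ae_all_iff.2 fun N => ?_
        have h1 := (isSymbol_cutoff_one (n := n) N).coeFn_mulOp (F f)
        rw [hf N] at h1
        filter_upwards [h1, Lp.coeFn_zero ℂ 2
          (volume : Measure (EuclideanSpace ℝ (Fin n)))] with ξ h2 h3
        rw [← h2, h3, Pi.zero_apply]
      filter_upwards [hall, Lp.coeFn_zero ℂ 2
        (volume : Measure (EuclideanSpace ℝ (Fin n)))] with ξ h1 h2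
      obtain ⟨N, hN⟩ := exists_nat_gt ‖ξ‖
      have h3 := h1 N
      rw [cutoff, indicator_of_mem (mem_ball_zero_iff.2 hN), Complex.ofReal_one, one_mul] at h3
      rw [h3, h2, Pi.zero_apply]
    have h4 : (𝓕⁻ (𝓕 f : L2 n) : L2 n) = f := FourierTransform.fourierInv_fourier_eq f
    rw [← h4]
    change (𝓕⁻ (F f) : L2 n) = 0
    rw [hFf]
    exact (fourierInvCLM ℂ (L2 n) (F := L2 n)).map_zero
  exact ⟨hzero _ fun R => (key R t ht).1, hzero _ fun R => (key R t ht).2⟩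

theorem IsSolutionWithData.unique {b : ℝ → ℝ} (hb : Continuous b) {f : L2Pair n}
    {u₁ u₁' u₂ u₂' : ℝ → L2 n} (h₁ : IsSolutionWithData b f u₁ u₁')
    (h₂ : IsSolutionWithData b f u₂ u₂') {t : ℝ} (ht : 0 ≤ t) :
    u₁ t = u₂ t ∧ u₁' t = u₂' t := by
  have h := h₁.1.smul_add (-1) h₂.1
  have hu : u₁ 0 = u₂ 0 := by
    have hF : (𝓕 (u₁ 0) : L2 n) = 𝓕 (u₂ 0) := by
      refine Lp.ext ?_
      filter_upwards [h₁.2.1, h₂.2.1] with ξ e1 e2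
      rw [e1] at e2
      refine mul_left_cancel₀ ?_ e2
      have : 0 < √(1 + (2 * Real.pi * ‖ξ‖) ^ 2) := by positivity
      exact_mod_cast this.ne'
    have := congrArg (fun f : L2 n => (𝓕⁻ f : L2 n)) hF
    simpa only [FourierTransform.fourierInv_fourier_eq] using this
  have hut : u₁' 0 = u₂' 0 := by
    have := h₁.2.2.trans h₂.2.2.symm
    exact smul_right_injective _ (neg_ne_zero.2 Complex.I_ne_zero) this
  obtain ⟨e1, e2⟩ := h.eq_zero hb (by simp [hu]) (by simp [hut]) ht
  simp only [neg_smul, one_smul, neg_add_eq_zero] at e1 e2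
  exact ⟨e1, e2⟩

/-! ### The energy operator and its norm -/

lemma IsMode.const_mul {b : ℝ → ℝ} {r : ℝ} {v v' : ℝ → ℝ} (h : IsMode b r v v') (c : ℝ) :
    IsMode b r (fun t => c * v t) (fun t => c * v' t) where
  hasDeriv t ht := (h.hasDeriv t ht).const_mul c
  hasDeriv' t ht := by
    convert! (h.hasDeriv' t ht).const_mul c using 1
    ring

/-- The symbol that maps `⟨D⟩u(0)` to `u(t)` when `u_t(0) = 0`. -/
noncomputable def positionSymbol (b : ℝ → ℝ) (t : ℝ) (ξ : EuclideanSpace ℝ (Fin n)) : ℝ :=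
  (√(1 + (2 * Real.pi * ‖ξ‖) ^ 2))⁻¹ * mode b 1 0 (2 * Real.pi * ‖ξ‖) t

/-- The time derivative of `positionSymbol`. -/
noncomputable def positionSymbolDeriv (b : ℝ → ℝ) (t : ℝ) (ξ : EuclideanSpace ℝ (Fin n)) : ℝ :=
  (√(1 + (2 * Real.pi * ‖ξ‖) ^ 2))⁻¹ * modeDeriv b 1 0 (2 * Real.pi * ‖ξ‖) t

/-- The symbol that maps `u_t(0)` to `u(t)` when `u(0) = 0`. -/
noncomputable def velocitySymbol (b : ℝ → ℝ) (t : ℝ) (ξ : EuclideanSpace ℝ (Fin n)) : ℝ :=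
  mode b 0 1 (2 * Real.pi * ‖ξ‖) t

/-- The time derivative of `velocitySymbol`. -/
noncomputable def velocitySymbolDeriv (b : ℝ → ℝ) (t : ℝ) (ξ : EuclideanSpace ℝ (Fin n)) : ℝ :=
  modeDeriv b 0 1 (2 * Real.pi * ‖ξ‖) t

lemma bracket_pos (ξ : EuclideanSpace ℝ (Fin n)) : 0 < √(1 + (2 * Real.pi * ‖ξ‖) ^ 2) := by
  positivity

lemma isSymbolFlow_position {b : ℝ → ℝ} (hb : Continuous b) :
    IsSymbolFlow (n := n) b (positionSymbol b) (positionSymbolDeriv b) where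
  measurable t := Measurable.mul (by fun_prop)
    ((measurable_mode hb 1 0 t).comp (measurable_norm.const_mul _))
  measurable' t := Measurable.mul (by fun_prop)
    ((measurable_modeDeriv hb 1 0 t).comp (measurable_norm.const_mul _))
  isMode ξ := (isMode_mode hb 1 0 _).const_mul _
  data_le ξ := by
    simp only [positionSymbol, positionSymbolDeriv, mode_zero_time, modeDeriv_zero_time]
    rw [mul_one, inv_pow, Real.sq_sqrt (by positivity), mul_inv_cancel₀ (by positivity)]
    simp

lemma isSymbolFlow_velocity {b : ℝ → ℝ} (hb : Continuous b) :
    IsSymbolFlow (n := n) b (velocitySymbol b) (velocitySymbolDeriv b) where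
  measurable t := (measurable_mode hb 0 1 t).comp (measurable_norm.const_mul _)
  measurable' t := (measurable_modeDeriv hb 0 1 t).comp (measurable_norm.const_mul _)
  isMode ξ := isMode_mode hb 0 1 _
  data_le ξ := by
    simp [velocitySymbol, velocitySymbolDeriv, mode_zero_time, modeDeriv_zero_time]

/-- The Fourier multiplier with the symbol `m` on `L²`. -/
noncomputable def multiplier (m : EuclideanSpace ℝ (Fin n) → ℝ) : L2 n →L[ℂ] L2 n :=
  fourierInvCLM ℂ (L2 n) ∘L mulOp m ∘L fourierCLM ℂ (L2 n)

lemma multiplier_apply (m : EuclideanSpace ℝ (Fin n) → ℝ) (f : L2 n) :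
    multiplier m f = (𝓕⁻ (mulOp m (𝓕 f : L2 n)) : L2 n) := rfl

lemma norm_multiplier_apply (m : EuclideanSpace ℝ (Fin n) → ℝ) (f : L2 n) :
    ‖multiplier m f‖ = ‖mulOp m (𝓕 f : L2 n)‖ := by
  rw [multiplier_apply, ← Lp.norm_fourier_eq, FourierTransform.fourier_fourierInv_eq]

lemma IsSymbol.norm_multiplier_le {C : ℝ} {m : EuclideanSpace ℝ (Fin n) → ℝ} (h : IsSymbol C m)
    (f : L2 n) : ‖multiplier m f‖ ≤ C * ‖f‖ := by
  rw [norm_multiplier_apply, ← Lp.norm_fourier_eq f]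
  exact h.norm_mulOp_le _

lemma multiplier_of_forall_eq_zero {m : EuclideanSpace ℝ (Fin n) → ℝ} (h : ∀ ξ, m ξ = 0)
    (f : L2 n) : multiplier m f = 0 := by
  have hm : m = fun _ => 0 := funext h
  have h1 : IsSymbol 0 m := ⟨hm ▸ measurable_const, fun ξ => by simp [h ξ]⟩
  simpa using h1.norm_multiplier_le f

lemma multiplier_of_forall_eq_one {m : EuclideanSpace ℝ (Fin n) → ℝ} (h : ∀ ξ, m ξ = 1)
    (f : L2 n) : multiplier m f = f := by
  have hm : m = fun _ => 1 := funext h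
  have h1 : IsSymbol 1 m := ⟨hm ▸ measurable_const, fun ξ => by simp [h ξ]⟩
  have h2 : mulOp m (𝓕 f : L2 n) = 𝓕 f := by
    refine Lp.ext ?_
    filter_upwards [h1.coeFn_mulOp (𝓕 f : L2 n)] with ξ hξ
    rw [hξ, h, Complex.ofReal_one, one_mul]
  rw [multiplier_apply, h2, FourierTransform.fourierInv_fourier_eq]

/-- The solution with data `f = (⟨D⟩u₁, u₂)`. -/
noncomputable def solution (b : ℝ → ℝ) (f : L2Pair n) (t : ℝ) : L2 n :=
  Complex.I • multiplier (velocitySymbol b t) f.snd + multiplier (positionSymbol b t) f.fst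

/-- The time derivative of `solution`. -/
noncomputable def solutionDeriv (b : ℝ → ℝ) (f : L2Pair n) (t : ℝ) : L2 n :=
  Complex.I • multiplier (velocitySymbolDeriv b t) f.snd +
    multiplier (positionSymbolDeriv b t) f.fst

theorem isSolutionWithData_solution {b : ℝ → ℝ} (hb : Continuous b) (h0 : ∀ t, 0 ≤ b t)
    (f : L2Pair n) : IsSolutionWithData b f (solution b f) (solutionDeriv b f) := by
  have hp := isSymbolFlow_position (n := n) hb
  have hq := isSymbolFlow_velocity (n := n) hb
  refine ⟨(hq.isEnergySolution hb h0 _).smul_add Complex.I (hp.isEnergySolution hb h0 _), ?_, ?_⟩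
  · have h := isMultiplierImage_fourierInv (m := fun r => √(1 + r ^ 2)) (hp.isSymbol h0 le_rfl)
      (hp.isSymbol_bracket_mul h0 le_rfl) (fun ξ => rfl) (𝓕 f.fst)
    rw [← multiplier_apply, ← multiplier_apply, multiplier_of_forall_eq_one
      (m := fun ξ => √(1 + (2 * Real.pi * ‖ξ‖) ^ 2) * positionSymbol b 0 ξ) (fun ξ => by
        rw [positionSymbol, mode_zero_time, mul_one, mul_inv_cancel₀ (bracket_pos ξ).ne'])
      f.fst] at h
    rw [solution, multiplier_of_forall_eq_zero
      (fun ξ => by simp [velocitySymbol, mode_zero_time]) f.snd, smul_zero, zero_add]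
    exact h
  · rw [solutionDeriv, multiplier_of_forall_eq_one
      (fun ξ => by simp [velocitySymbolDeriv, modeDeriv_zero_time]) f.snd,
      multiplier_of_forall_eq_zero
      (fun ξ => by simp [positionSymbolDeriv, modeDeriv_zero_time]) f.fst, add_zero, smul_smul]
    simp

/-- The energy operator `(⟨D⟩u₁, u₂) ↦ (|D|u(t), D_t u(t))`, as a matrix of Fourier multipliers. -/
noncomputable def energyOp (n : ℕ) (b : ℝ → ℝ) (t : ℝ) : L2Pair n →L[ℂ] L2Pair n :=
  (WithLp.prodContinuousLinearEquiv 2 ℂ (L2 n) (L2 n)).symm.toContinuousLinearMap ∘L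
    ((Complex.I • multiplier (fun ξ => 2 * Real.pi * ‖ξ‖ * velocitySymbol b t ξ) ∘L
          WithLp.sndL 2 ℂ (L2 n) (L2 n) +
        multiplier (fun ξ => 2 * Real.pi * ‖ξ‖ * positionSymbol b t ξ) ∘L
          WithLp.fstL 2 ℂ (L2 n) (L2 n)).prod
      ((-Complex.I) • (Complex.I • multiplier (velocitySymbolDeriv b t) ∘L
          WithLp.sndL 2 ℂ (L2 n) (L2 n) +
        multiplier (positionSymbolDeriv b t) ∘L WithLp.fstL 2 ℂ (L2 n) (L2 n))))

lemma energyOp_fst (b : ℝ → ℝ) (t : ℝ) (f : L2Pair n) :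
    (energyOp n b t f).fst =
      Complex.I • multiplier (fun ξ => 2 * Real.pi * ‖ξ‖ * velocitySymbol b t ξ) f.snd +
        multiplier (fun ξ => 2 * Real.pi * ‖ξ‖ * positionSymbol b t ξ) f.fst := rfl

lemma energyOp_snd (b : ℝ → ℝ) (t : ℝ) (f : L2Pair n) :
    (energyOp n b t f).snd = (-Complex.I) • solutionDeriv b f t := rfl

theorem isEnergyOperator_energyOp {b : ℝ → ℝ} (hb : Continuous b) (h0 : ∀ t, 0 ≤ b t) :
    IsEnergyOperator b (energyOp n b) where
  exists_solution f := ⟨_, _, isSolutionWithData_solution hb h0 f⟩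
  energy_eq f u ut h t ht := by
    have hp := isSymbolFlow_position (n := n) hb
    have hq := isSymbolFlow_velocity (n := n) hb
    obtain ⟨e1, e2⟩ := h.unique hb (isSolutionWithData_solution hb h0 f) ht
    rw [e1, e2]
    refine ⟨?_, energyOp_snd b t f⟩
    rw [energyOp_fst]
    exact (isMultiplierImage_fourierInv (m := fun r => r) (hq.isSymbol h0 ht)
      (hq.isSymbol_freq_mul h0 ht) (fun ξ => rfl) (𝓕 f.snd)).smul_add Complex.I
      (isMultiplierImage_fourierInv (m := fun r => r) (hp.isSymbol h0 ht)
        (hp.isSymbol_freq_mul h0 ht) (fun ξ => rfl) (𝓕 f.fst))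

section Norm

variable {b b' : ℝ → ℝ} {A B : ℝ}

lemma IsNoneffective.exists_isSymbol_le (H : IsNoneffective b b' A B) :
    ∃ C > 0, ∀ m m' : ℝ → EuclideanSpace ℝ (Fin n) → ℝ, IsSymbolFlow b m m' → ∀ t ≥ 0,
      IsSymbol (C * (1 / lam b t)) (fun ξ => 2 * Real.pi * ‖ξ‖ * m t ξ) ∧
        IsSymbol (C * (1 / lam b t)) (m' t) := by
  obtain ⟨C, hC, hyp⟩ := H.exists_upper_bound
  refine ⟨√C, Real.sqrt_pos.2 hC, fun m m' h t ht => ?_⟩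
  have hl := lam_pos b t
  have key : ∀ ξ, (lam b t * (2 * Real.pi * ‖ξ‖ * m t ξ)) ^ 2 + (lam b t * m' t ξ) ^ 2 ≤ C := by
    intro ξ
    have h1 := hyp _ _ _ t (by positivity : 0 ≤ 2 * Real.pi * ‖ξ‖) (h.isMode ξ) ht
    have h2 := mul_le_mul_of_nonneg_left (h.data_le ξ) hC.le
    nlinarith
  have conv : ∀ x : ℝ, (lam b t * x) ^ 2 ≤ C → |x| ≤ √C * (1 / lam b t) := by
    intro x hx
    have h1 := Real.abs_le_sqrt hx
    rw [abs_mul, abs_of_pos hl] at h1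
    rw [mul_one_div, le_div_iff₀ hl, mul_comm]
    exact h1
  exact ⟨⟨(h.isSymbol_freq_mul H.nonneg ht).1, fun ξ => conv _ (by
      nlinarith [key ξ, sq_nonneg (lam b t * m' t ξ)])⟩,
    ⟨h.measurable' t, fun ξ => conv _ (by
      nlinarith [key ξ, sq_nonneg (lam b t * (2 * Real.pi * ‖ξ‖ * m t ξ))])⟩⟩

lemma IsNoneffective.exists_norm_energyOp_le (H : IsNoneffective b b' A B) :
    ∃ C > 0, ∀ t ≥ 0, ‖energyOp n b t‖ ≤ C * (1 / lam b t) := by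
  obtain ⟨C, hC, hyp⟩ := H.exists_isSymbol_le (n := n)
  refine ⟨4 * C, by positivity, fun t ht => ?_⟩
  obtain ⟨p1, p2⟩ := hyp _ _ (isSymbolFlow_position H.continuous) t ht
  obtain ⟨q1, q2⟩ := hyp _ _ (isSymbolFlow_velocity H.continuous) t ht
  have hK : 0 ≤ C * (1 / lam b t) := by have := lam_pos b t; positivity
  refine ContinuousLinearMap.opNorm_le_bound _ (by linarith) fun f => ?_
  have hf1 : ‖f.fst‖ ≤ ‖f‖ := WithLp.norm_fst_le _ f
  have hf2 : ‖f.snd‖ ≤ ‖f‖ := WithLp.norm_snd_le _ f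
  have comb : ∀ {p q : EuclideanSpace ℝ (Fin n) → ℝ}, IsSymbol (C * (1 / lam b t)) p →
      IsSymbol (C * (1 / lam b t)) q →
      ‖Complex.I • multiplier q f.snd + multiplier p f.fst‖ ≤ 2 * (C * (1 / lam b t)) * ‖f‖ := by
    intro p q hp hq
    refine (norm_add_le _ _).trans ?_
    rw [norm_smul, Complex.norm_I, one_mul]
    have h1 := (hq.norm_multiplier_le f.snd).trans (mul_le_mul_of_nonneg_left hf2 hK)
    have h2 := (hp.norm_multiplier_le f.fst).trans (mul_le_mul_of_nonneg_left hf1 hK)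
    linarith
  have e1 := comb p1 q1
  rw [← energyOp_fst] at e1
  have e2 : ‖(energyOp n b t f).snd‖ ≤ 2 * (C * (1 / lam b t)) * ‖f‖ := by
    rw [energyOp_snd, norm_smul, norm_neg, Complex.norm_I, one_mul]
    exact comb p2 q2
  have h3 := WithLp.prod_norm_sq_eq_of_L2 (energyOp n b t f)
  have h4 : ‖energyOp n b t f‖ ≤ ‖(energyOp n b t f).fst‖ + ‖(energyOp n b t f).snd‖ := by
    refine le_of_sq_le_sq ?_ (by positivity)
    nlinarith [norm_nonneg (energyOp n b t f).fst, norm_nonneg (energyOp n b t f).snd]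
  linarith

/-- A nonzero function in `L²` whose Fourier transform lives where `|2πξ| ≥ 1`. -/
lemma exists_high_frequency (hn : 1 ≤ n) :
    ∃ g : L2 n, g ≠ 0 ∧ ∀ᵐ ξ, (𝓕 g : L2 n) ξ ≠ 0 → 1 ≤ 2 * Real.pi * ‖ξ‖ := by
  set S : Set (EuclideanSpace ℝ (Fin n)) := {ξ | 1 < 2 * Real.pi * ‖ξ‖} ∩ Metric.ball 0 1
  have hopen : IsOpen S :=
    (isOpen_lt continuous_const (by fun_prop)).inter Metric.isOpen_ball
  have hne : S.Nonempty := by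
    refine ⟨EuclideanSpace.single ⟨0, hn⟩ (1 / 2), ?_, ?_⟩
    · have h3 := Real.pi_gt_three
      simp only [mem_ofPred_eq, PiLp.norm_single]
      norm_num
      linarith
    · rw [mem_ball_zero_iff, PiLp.norm_single]
      norm_num
  have hpos : volume S ≠ 0 := (hopen.measure_pos volume hne).ne'
  have hfin : volume S ≠ ⊤ := ((measure_mono inter_subset_right).trans_lt
    measure_ball_lt_top).ne
  set h : L2 n := indicatorConstLp 2 hopen.measurableSet hfin (1 : ℂ)
  have hF : (𝓕 (𝓕⁻ h : L2 n) : L2 n) = h := FourierTransform.fourier_fourierInv_eq h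
  refine ⟨𝓕⁻ h, fun h0 => ?_, ?_⟩
  · have h1 : ‖h‖ = 0 := by
      rw [← hF, Lp.norm_fourier_eq, h0, norm_zero]
    rw [norm_indicatorConstLp two_ne_zero ENNReal.ofNat_ne_top, norm_one, one_mul] at h1
    have h2 : 0 < volume.real S := ENNReal.toReal_pos hpos hfin
    exact (Real.rpow_pos_of_pos h2 _).ne' h1
  · rw [hF]
    filter_upwards [indicatorConstLp_coeFn (p := 2) (hs := hopen.measurableSet) (hμs := hfin)
      (c := (1 : ℂ))] with ξ hξ hne
    have hmem : ξ ∈ S := by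
      by_contra hc
      exact hne (hξ.trans (indicator_of_notMem hc _))
    exact hmem.1.le

lemma IsNoneffective.exists_le_norm_energyOp (H : IsNoneffective b b' A B) (hn : 1 ≤ n) :
    ∃ c > 0, ∀ t ≥ 0, c * (1 / lam b t) ≤ ‖energyOp n b t‖ := by
  obtain ⟨c, hc, hyp⟩ := H.exists_lower_bound
  obtain ⟨g, hg0, hg⟩ := exists_high_frequency hn
  refine ⟨√c, Real.sqrt_pos.2 hc, fun t ht => ?_⟩
  have hl := lam_pos b t
  have hq := isSymbolFlow_velocity (n := n) H.continuous
  set f : L2Pair n := WithLp.toLp 2 (0, g)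
  have hfst : f.fst = 0 := rfl
  have hsnd : f.snd = g := rfl
  have hf : ‖f‖ = ‖g‖ := by
    have := WithLp.prod_norm_sq_eq_of_L2 f
    rw [hfst, hsnd, norm_zero] at this
    exact (sq_eq_sq₀ (norm_nonneg _) (norm_nonneg _)).1 (by simpa using this)
  have hEf : ‖energyOp n b t f‖ ^ 2 =
      ‖mulOp (fun ξ => 2 * Real.pi * ‖ξ‖ * velocitySymbol b t ξ) (𝓕 g : L2 n)‖ ^ 2 +
        ‖mulOp (velocitySymbolDeriv b t) (𝓕 g : L2 n)‖ ^ 2 := by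
    rw [WithLp.prod_norm_sq_eq_of_L2, energyOp_fst, energyOp_snd, solutionDeriv, hfst, hsnd,
      map_zero, map_zero, add_zero, add_zero, norm_smul, norm_smul, norm_smul, norm_neg,
      Complex.norm_I, one_mul, one_mul, one_mul, norm_multiplier_apply, norm_multiplier_apply]
  have hlow : c / lam b t ^ 2 * ‖g‖ ^ 2 ≤ ‖energyOp n b t f‖ ^ 2 := by
    rw [hEf, ← Lp.norm_fourier_eq g, L2.norm_sq_eq_integral, L2.norm_sq_eq_integral,
      L2.norm_sq_eq_integral, ← integral_add (L2.integrable_norm_sq _) (L2.integrable_norm_sq _),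
      ← integral_const_mul]
    refine integral_mono_ae ((L2.integrable_norm_sq _).const_mul _)
      ((L2.integrable_norm_sq _).add (L2.integrable_norm_sq _)) ?_
    filter_upwards [hg, (hq.isSymbol_freq_mul H.nonneg ht).coeFn_mulOp (𝓕 g : L2 n),
      (hq.isSymbol_deriv H.nonneg ht).coeFn_mulOp (𝓕 g : L2 n)] with ξ h1 h2 h3
    rw [h2, h3, norm_mul, norm_mul, Complex.norm_real, Complex.norm_real, mul_pow, mul_pow,
      ← add_mul, Real.norm_eq_abs, Real.norm_eq_abs, sq_abs, sq_abs]
    by_cases h4 : (𝓕 g : L2 n) ξ = 0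
    · simp [h4]
    · refine mul_le_mul_of_nonneg_right ?_ (sq_nonneg _)
      have h5 := hyp _ _ _ t (h1 h4) (hq.isMode ξ) ht
      simp only [velocitySymbol, velocitySymbolDeriv, mode_zero_time, modeDeriv_zero_time] at h5 ⊢
      rw [div_le_iff₀ (by positivity), mul_pow]
      nlinarith
  have hgpos : 0 < ‖g‖ := norm_pos_iff.2 hg0
  have h6 : √c * (1 / lam b t) * ‖g‖ ≤ ‖energyOp n b t f‖ := by
    refine le_of_sq_le_sq ?_ (norm_nonneg _)
    rw [mul_pow, mul_pow, Real.sq_sqrt hc.le, one_div, inv_pow, ← div_eq_mul_inv]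
    exact hlow
  have h7 := (energyOp n b t).le_opNorm f
  rw [hf] at h7
  exact le_of_mul_le_mul_right (h6.trans h7) hgpos

end Norm

/-- An energy operator only depends on the coefficient on `[0, ∞)`. -/
lemma IsEnergyOperator.congr {b β : ℝ → ℝ} (h : EqOn b β (Ici 0))
    {E : ℝ → L2Pair n →L[ℂ] L2Pair n} (hE : IsEnergyOperator b E) : IsEnergyOperator β E where
  exists_solution f := by
    obtain ⟨u, ut, hu, hdata⟩ := hE.exists_solution f
    exact ⟨u, ut, hu.congr h, hdata⟩
  energy_eq f u ut hu := hE.energy_eq f u ut ⟨hu.1.congr h.symm, hu.2⟩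

end DampedWave

theorem mainTheorem6 (n : ℕ) (hn : 1 ≤ n) (b : ℝ → ℝ)
    (hsmooth : ContDiffOn ℝ ∞ b (Ici 0))
    (H1 : ∀ t ≥ 0, 0 ≤ b t)
    (H2 : MonotoneOn b (Ici 0) ∨ AntitoneOn b (Ici 0))
    (H3 : ∀ k : ℕ, 1 ≤ k → ∃ C : ℝ, ∀ t ≥ 0,
      |iteratedDerivWithin k b (Ici 0) t| ≤ C * b t * (1 / (1 + t)) ^ k)
    (NE : limsup (fun t : ℝ => ((t * b t : ℝ) : EReal)) atTop < 1) :
    ∃ E : ℝ → DampedWave.L2Pair n →L[ℂ] DampedWave.L2Pair n,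
      DampedWave.IsEnergyOperator b E ∧
      ∃ c C : ℝ, 0 < c ∧ 0 < C ∧ ∀ t ≥ 0,
        c * (1 / DampedWave.lam b t) ≤ ‖E t‖ ∧ ‖E t‖ ≤ C * (1 / DampedWave.lam b t) := by
  obtain ⟨b', A, B, H⟩ := DampedWave.exists_isNoneffective hsmooth H1 (H3 1 le_rfl) NE
  have hEq : EqOn (fun t => b (max t 0)) b (Ici 0) := fun t ht => by
    simp only [max_eq_left (show (0 : ℝ) ≤ t from ht)]
  obtain ⟨c, hc, hlow⟩ := H.exists_le_norm_energyOp hn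
  obtain ⟨C, hC, hup⟩ := H.exists_norm_energyOp_le (n := n)
  refine ⟨_, (DampedWave.isEnergyOperator_energyOp H.continuous H.nonneg).congr hEq,
    c, C, hc, hC, fun t ht => ?_⟩
  rw [← DampedWave.lam_congr hEq ht]
  exact ⟨hlow t ht, hup t ht⟩
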